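/- For $\alpha\in(0,1)$, an integer $n\ge 1$ and $b\in(0,1]$ put $$\Lambda_n(b)=\frac1b\int_0^{\infty}\frac{J_n(bt)J_n(t)}{t^{1-\alpha}}\,dt,\qquad \Theta_n=\Lambda_1(1)-\Lambda_n(1),$$ where $J_n$ is the Bessel function of the first kind; for $\Omega\in\mathbb R$ let $$M_n^\alpha=\begin{pmatrix}\Omega-\Theta_n+b^2\Lambda_1(b) & -b^2\Lambda_n(b)\\ b\Lambda_n(b) & b\Omega+b^{1-\alpha}\Theta_n-b\Lambda_1(b)\end{pmatrix}.$$ Let $\gamma$ be Euler's constant, $\zeta$ the Riemann zeta function, and $$c_\alpha=\sum_{m=1}^\infty\frac{\alpha^{2m+1}}{2^{2m}(2m+1)}\zeta(2m+1),\qquad \kappa=\Big(1-\frac\alpha2\Big)\Lambda_1(1)\,e^{\alpha\gamma+c_\alpha}.$$ Let $\alpha,b\in(0,1)$. Then the integrals defining $\Lambda_n(\beta)$, $n\ge1$, $\beta\in(0,1]$, converge absolutely, and: 1. For all $n\ge1$, $\Theta_n\ge0$ and $\Lambda_n(b)\ge0$. For each $n\ge1$ the map $\beta\in(0,1)\mapsto\Lambda_n(\beta)$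 is strictly increasing; $n\ge1\mapsto\Theta_n$ is strictly increasing and $n\ge1\mapsto\Lambda_n(b)$ is strictly decreasing. 2. For every $n\ge2$ (with $b$ fixed and $\alpha$ varying in $(0,1)$), $$\lim_{\alpha\to0}\Theta_n=\frac{n-1}{2n},\qquad \lim_{\alpha\to0}\Lambda_n(b)=\frac{b^{n-1}}{2n},$$ $$\lim_{\alpha\to1}\Theta_n=\frac2\pi\sum_{k=1}^{n-1}\frac1{2k+1},\qquad \lim_{\alpha\to1}\Lambda_n(b)=\frac1b\int_0^{\infty}J_n(bt)J_n(t)\,dt,$$ the last integral being a convergent improper integral $\lim_{R\to\infty}\int_0^R$. 3. As $n\to\infty$, $$\Lambda_n(b)=O(b^{n-1}),\qquad \Lambda_n(b)\to0,\qquad \Theta_n=\Lambda_1(1)-\frac{\kappa}{n^{1-\alpha}}+O\Big(\frac1{n^{2-\alpha}}\Big),\qquad \Theta_n\to\Lambda_1(1).$$ 4. For every $\Omega\in\mathbb R$, as $n\to\infty$, $$\det M_n^\alpha=\mu+\frac{\nu}{n^{1-\alpha}}-\frac{b^{1-\alpha}\kappa^2}{n^{2-2\alpha}}+O\Big(\frac1{n^{2-\alpha}}\Big),\qquad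 \det M_n^\alpha\to\mu,$$ where $$\mu=\big(\Omega-\Lambda_1(1)+b^2\Lambda_1(b)\big)\big(b\Omega+b^{1-\alpha}\Lambda_1(1)-b\Lambda_1(b)\big),$$ $$\nu=\Big(1-\frac\alpha2\Big)\Lambda_1(1)\Big(2b^{1-\alpha}\Lambda_1(1)+(b-b^{1-\alpha})\Omega-b(1+b^{2-\alpha})\Lambda_1(b)\Big)e^{\alpha\gamma+c_\alpha}.$$ -/

import Mathlib

open Set Filter Topology Asymptotics MeasureTheory

noncomputable section

namespace VState

/-- The Bessel function of the first kind `J_n` of integer order `n ≥ 0` at a real argument,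
by its (everywhere absolutely convergent) power series. -/
def besselJ (n : ℕ) (x : ℝ) : ℝ :=
  ∑' k : ℕ, (-1 : ℝ) ^ k / ((k.factorial : ℝ) * ((n + k).factorial : ℝ)) * (x / 2) ^ (2 * k + n)

/-- The integrand `J_n(bt) J_n(t) / t^{1-α}`. -/
def lambdaIntegrand (α : ℝ) (n : ℕ) (b t : ℝ) : ℝ :=
  besselJ n (b * t) * besselJ n t / t ^ (1 - α)

/-- `Λ_n(b) = (1/b) ∫_0^∞ J_n(bt) J_n(t) / t^{1-α} dt`. -/
def Lam (α : ℝ) (n : ℕ) (b : ℝ) : ℝ :=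
  1 / b * ∫ t in Ioi (0 : ℝ), lambdaIntegrand α n b t

/-- `Θ_n = Λ_1(1) - Λ_n(1)`. -/
def Theta (α : ℝ) (n : ℕ) : ℝ :=
  Lam α 1 1 - Lam α n 1

/-- The matrix `M_n^α`. -/
def M (α b Ω : ℝ) (n : ℕ) : Matrix (Fin 2) (Fin 2) ℝ :=
  !![Ω - Theta α n + b ^ 2 * Lam α 1 b, -b ^ 2 * Lam α n b;
     b * Lam α n b, b * Ω + b ^ (1 - α) * Theta α n - b * Lam α 1 b]

/-- `c_α = ∑_{m ≥ 1} α^{2m+1} / (2^{2m} (2m+1)) · ζ(2m+1)`, with the summation index shifted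
so that `j = m - 1` starts at `0`. -/
def cAlpha (α : ℝ) : ℝ :=
  ∑' j : ℕ, α ^ (2 * (j + 1) + 1) / (2 ^ (2 * (j + 1)) * (2 * ((j : ℝ) + 1) + 1)) *
    (riemannZeta (2 * ((j : ℂ) + 1) + 1)).re

/-- `κ = (1 - α/2) Λ_1(1) e^{αγ + c_α}`, with `γ` Euler's constant. -/
def kappa (α : ℝ) : ℝ :=
  (1 - α / 2) * Lam α 1 1 * Real.exp (α * Real.eulerMascheroniConstant + cAlpha α)

/-- The limit `μ` of `det M_n^α`. -/
def mu (α b Ω : ℝ) : ℝ :=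
  (Ω - Lam α 1 1 + b ^ 2 * Lam α 1 b) *
    (b * Ω + b ^ (1 - α) * Lam α 1 1 - b * Lam α 1 b)

/-- The coefficient `ν` of `1 / n^{1-α}` in the expansion of `det M_n^α`. -/
def nu (α b Ω : ℝ) : ℝ :=
  (1 - α / 2) * Lam α 1 1 *
    (2 * b ^ (1 - α) * Lam α 1 1 + (b - b ^ (1 - α)) * Ω
      - b * (1 + b ^ (2 - α)) * Lam α 1 b) *
    Real.exp (α * Real.eulerMascheroniConstant + cAlpha α)

end VState

end

/-! Everything rests on one representation. With `α = 2s` and `0 < s < 1/2`, Λ_n(b) =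
2^(2s-1)/Γ(1-s)² · b^(n-1) · ∫₀¹ x^(n+s-1) (1-x)^(-s) (1-b²x)^(-s) dx (`Lam_eq_eulerIntegral`). To
reach it, the power t^(2s-2) is written as a superposition of Gaussians exp(-t²/(4u)). Fubini and
Weber's second exponential integral then leave an integral of the modified Bessel function I_n
against u^(s-1) e^(-(1+b²)u). Replacing I_n by its Fourier integral gives the Fourier coefficients
of (1+b²-2b cos θ)^(-s) = |(1-b e^(iθ))^(-s)|², a power series in b² whose coefficients are Beta
integrals. The case b = 1 follows by left continuity and is a quotient of Gamma functions
(`Lam_one_eq`).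

Signs, monotonicity in b and n, the bound O(b^(n-1)) and the limit `α → 0` are read off the positive
Euler integrand. For Θ_n, consecutive differences Λ_n(1) - Λ_(n+1)(1) are explicit and positive, and
they stay finite as `α → 1` because Γ(1-α) is multiplied by 1-α (`Lam_one_sub_Lam_one_succ`);
summing them gives both the monotonicity and the limit.

For b < 1 the limit `α → 1` leads to an integral treated here as an improper one. Integration by
parts against Lommel's primitive of t J_n(bt) J_n(t) replaces it by an absolutely convergent
integral on which dominated convergence works (`exists_tendsto_integral_mul_besselJ`).

As n → ∞, Wendel's inequalities give Γ(n+s)/Γ(n+1-s) = n^(2s-1) (1 + O(1/n)). The constant in front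
is κ because e^(αγ+c_α) = Γ(1-α/2)/Γ(1+α/2), which is the Taylor series of log Γ (`exp_cAlpha_eq`,
`kappa_eq`). The determinant expansion is then algebra: `det_M_sub_eq` is an exact identity whose
right side is visibly small. -/

namespace VState

/-! ### Power series, recurrences and derivatives of J_n. -/

/-- The entire function `y ↦ ∑ (-1)^k y^k / (k! (n+k)!)`, so that `J_n(x) = (x/2)^n G_n(x²/4)`. -/
noncomputable def besselSeries (n : ℕ) (y : ℝ) : ℝ :=
  ∑' k : ℕ, (-1 : ℝ) ^ k / ((k.factorial : ℝ) * ((n + k).factorial : ℝ)) * y ^ k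

lemma abs_besselSeries_coeff_le (n k : ℕ) :
    |(-1 : ℝ) ^ k / ((k.factorial : ℝ) * ((n + k).factorial : ℝ))| ≤ 1 / (k.factorial : ℝ) := by
  have h1 : (1 : ℝ) ≤ (n + k).factorial := by exact_mod_cast Nat.succ_le_of_lt (Nat.factorial_pos _)
  have h2 : (0 : ℝ) < k.factorial := by exact_mod_cast Nat.factorial_pos _
  rw [abs_div, abs_pow, abs_neg, abs_one, one_pow, abs_of_pos (by positivity)]
  exact one_div_le_one_div_of_le h2 (le_mul_of_one_le_right h2.le h1)

lemma summable_besselSeries (n : ℕ) (y : ℝ) : Summable fun k : ℕ =>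
    (-1 : ℝ) ^ k / ((k.factorial : ℝ) * ((n + k).factorial : ℝ)) * y ^ k := by
  refine Summable.of_norm_bounded (Real.summable_pow_div_factorial |y|) fun k => ?_
  rw [Real.norm_eq_abs, abs_mul, abs_pow, show |y| ^ k / (k.factorial : ℝ) = 1 / k.factorial * |y| ^ k by ring]
  exact mul_le_mul_of_nonneg_right (abs_besselSeries_coeff_le n k) (by positivity)

/-- Termwise differentiation on the ball of radius |y| + 1, where k R^(k-1)/k! is a summable
majorant; shifting the index turns the differentiated series into the next one. -/
lemma hasDerivAt_besselSeries (n : ℕ) (y : ℝ) :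
    HasDerivAt (besselSeries n) (-besselSeries (n + 1) y) y := by
  set R := |y| + 1
  have hR : 0 < R := by positivity
  have hu : Summable fun k : ℕ => (1 / (k.factorial : ℝ)) * (k * R ^ (k - 1)) := by
    rw [← summable_nat_add_iff 1]
    refine (Real.summable_pow_div_factorial R).congr fun k => ?_
    have : ((k + 1).factorial : ℝ) = (k + 1) * k.factorial := by
      rw [Nat.factorial_succ]; push_cast; ring
    rw [this]
    have h2 : (k.factorial : ℝ) ≠ 0 := by exact_mod_cast Nat.factorial_ne_zero _
    have : (k : ℝ) + 1 ≠ 0 := by positivity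
    push_cast
    field_simp
  have key := hasDerivAt_tsum_of_isPreconnected (t := Metric.ball (0 : ℝ) R) (y₀ := 0) (y := y)
    (g := fun k y => (-1 : ℝ) ^ k / ((k.factorial : ℝ) * ((n + k).factorial : ℝ)) * y ^ k)
    (g' := fun k y => (-1 : ℝ) ^ k / ((k.factorial : ℝ) * ((n + k).factorial : ℝ)) *
      (k * y ^ (k - 1))) hu Metric.isOpen_ball (convex_ball _ _).isPreconnected
    (fun k z _ => (hasDerivAt_pow k z).const_mul _) (fun k z hz => by
      rw [Real.norm_eq_abs, abs_mul, abs_mul, abs_pow, Nat.abs_cast]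
      have : |z| ≤ R := by simpa using (Metric.mem_ball.1 hz).le
      have := abs_besselSeries_coeff_le n k
      gcongr)
    (Metric.mem_ball_self hR) (summable_besselSeries n 0) (by simp [R])
  refine key.congr_deriv ?_
  have hs : Summable fun k : ℕ => (-1 : ℝ) ^ k / ((k.factorial : ℝ) * ((n + k).factorial : ℝ)) *
      (k * y ^ (k - 1)) := by
    refine Summable.of_norm_bounded hu fun k => ?_
    rw [Real.norm_eq_abs, abs_mul, abs_mul, abs_pow, Nat.abs_cast]
    have : |y| ≤ R := by simp [R]
    have := abs_besselSeries_coeff_le n k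
    gcongr
  rw [hs.tsum_eq_zero_add, besselSeries, ← tsum_neg]
  simp only [Nat.cast_zero, zero_mul, mul_zero, zero_add]
  refine tsum_congr fun k => ?_
  have h1 : ((k + 1).factorial : ℝ) = (k + 1) * k.factorial := by
    rw [Nat.factorial_succ]; push_cast; ring
  have h2 : (k.factorial : ℝ) ≠ 0 := by exact_mod_cast Nat.factorial_ne_zero _
  have h3 : ((n + 1 + k).factorial : ℝ) ≠ 0 := by exact_mod_cast Nat.factorial_ne_zero _
  have h4 : (k : ℝ) + 1 ≠ 0 := by positivity
  rw [h1, show n + (k + 1) = n + 1 + k by ring]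
  push_cast
  field_simp
  ring

/-- The three-term recurrence of `besselSeries`. -/
lemma besselSeries_recurrence (n : ℕ) (y : ℝ) :
    (n + 1) * besselSeries (n + 1) y = besselSeries n y + y * besselSeries (n + 2) y := by
  have hs := summable_besselSeries n y
  have hs1 := (summable_besselSeries (n + 1) y).mul_left ((n : ℝ) + 1)
  unfold besselSeries
  rw [← tsum_mul_left, ← tsum_mul_left, hs1.tsum_eq_zero_add, hs.tsum_eq_zero_add, add_assoc (_ / _ * _ : ℝ),
    ← Summable.tsum_add ((summable_nat_add_iff 1).2 hs) ((summable_besselSeries (n + 2) y).mul_left y)]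
  have fs : ∀ m : ℕ, ((m + 1).factorial : ℝ) = (m + 1) * m.factorial := fun m => by
    rw [Nat.factorial_succ]; push_cast; ring
  have f0 : ∀ m : ℕ, (m.factorial : ℝ) ≠ 0 := fun m => by exact_mod_cast Nat.factorial_ne_zero _
  congr 1
  · have := f0 n
    have h4 : (n : ℝ) + 1 ≠ 0 := by positivity
    simp only [add_zero, fs n, Nat.factorial_zero]
    field_simp
  · refine tsum_congr fun k => ?_
    have := f0 (n + k + 1)
    have := f0 k
    have h4 : (n : ℝ) + k + 1 + 1 ≠ 0 := by positivity
    have h5 : (k : ℝ) + 1 ≠ 0 := by positivity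
    rw [show n + 1 + (k + 1) = (n + k + 1) + 1 by ring, show n + (k + 1) = n + k + 1 by ring,
      show n + 2 + k = (n + k + 1) + 1 by ring, fs (n + k + 1), fs k]
    push_cast
    field_simp
    ring

lemma continuous_besselSeries (n : ℕ) : Continuous (besselSeries n) :=
  continuous_iff_continuousAt.2 fun y => (hasDerivAt_besselSeries n y).continuousAt

lemma besselJ_eq (n : ℕ) (x : ℝ) : besselJ n x = (x / 2) ^ n * besselSeries n ((x / 2) ^ 2) := by
  rw [besselJ, besselSeries, ← tsum_mul_left]
  refine tsum_congr fun k => ?_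
  rw [pow_add, pow_mul]; ring

lemma continuous_besselJ (n : ℕ) : Continuous (besselJ n) := by
  rw [show besselJ n = fun x => (x / 2) ^ n * besselSeries n ((x / 2) ^ 2) from
    funext (besselJ_eq n)]
  exact (by fun_prop : Continuous fun x : ℝ => (x / 2) ^ n).mul
    ((continuous_besselSeries n).comp (by fun_prop))

lemma hasDerivAt_besselJ (n : ℕ) {x : ℝ} (hx : x ≠ 0) :
    HasDerivAt (besselJ n) (n / x * besselJ n x - besselJ (n + 1) x) x := by
  rw [show besselJ n = fun x => (x / 2) ^ n * besselSeries n ((x / 2) ^ 2) from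
    funext (besselJ_eq n), besselJ_eq (n + 1)]
  have h1 : HasDerivAt (fun x : ℝ => x / 2) (1 / 2) x := (hasDerivAt_id x).div_const 2
  have h2 := (hasDerivAt_besselSeries n ((x / 2) ^ 2)).comp x (h1.pow 2)
  refine ((h1.pow n).mul h2).congr_deriv ?_
  simp only [Pi.pow_apply, Function.comp]
  rcases n with _ | n
  · simp; ring
  · simp only [Nat.add_sub_cancel]
    push_cast
    field_simp
    ring

lemma hasDerivAt_besselJ_succ (n : ℕ) {x : ℝ} (hx : x ≠ 0) :
    HasDerivAt (besselJ (n + 1)) (besselJ n x - (n + 1) / x * besselJ (n + 1) x) x := by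
  refine (hasDerivAt_besselJ (n + 1) hx).congr_deriv ?_
  have := besselSeries_recurrence n ((x / 2) ^ 2)
  simp only [besselJ_eq]
  push_cast
  have e : besselSeries n ((x / 2) ^ 2) = (n + 1) * besselSeries (n + 1) ((x / 2) ^ 2)
    - (x / 2) ^ 2 * besselSeries (n + 2) ((x / 2) ^ 2) := by linarith
  rw [e, show n + 1 + 1 = n + 2 from rfl]
  field_simp
  ring

/-! ### Decay of J_n on the half-line. -/

/-- The energy `x (J_n² + J_{n+1}²)` of the Bessel system is bounded. -/
lemma exists_mul_sq_add_sq_besselJ_le (n : ℕ) :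
    ∃ C : ℝ, ∀ x, 0 ≤ x → x * (besselJ n x ^ 2 + besselJ (n + 1) x ^ 2) ≤ C := by
  set N : ℝ := 2 * n + 1 with hN
  have hN0 : 0 < N := by positivity
  -- The energy has derivative N (J_n² - J_(n+1)²), which is too large to integrate. The cross term
  -- cancels it, leaving N J_n J_(n+1) / x.
  set G : ℝ → ℝ := fun x =>
    x * (besselJ n x ^ 2 + besselJ (n + 1) x ^ 2) - N * (besselJ n x * besselJ (n + 1) x)
  have hG : ∀ x, 0 < x → HasDerivAt G (N * (besselJ n x * besselJ (n + 1) x) / x) x := by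
    intro x hx
    have h1 := hasDerivAt_besselJ n hx.ne'
    have h2 := hasDerivAt_besselJ_succ n hx.ne'
    refine (((hasDerivAt_id x).mul ((h1.pow 2).add (h2.pow 2))).sub
      ((h1.mul h2).const_mul N)).congr_deriv ?_
    simp only [id, Pi.add_apply, Pi.pow_apply, hN]
    push_cast
    field_simp
    ring
  have hGlow : ∀ x, N ≤ x → x * (besselJ n x ^ 2 + besselJ (n + 1) x ^ 2) ≤ 2 * G x := by
    intro x hx
    simp only [G]
    nlinarith [mul_nonneg hN0.le (sq_nonneg (besselJ n x - besselJ (n + 1) x)),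
      mul_nonneg (sub_nonneg.2 hx) (add_nonneg (sq_nonneg (besselJ n x))
        (sq_nonneg (besselJ (n + 1) x)))]
  -- For x ≥ N one has G' ≤ (N/x²) G, and exp(N/x) is the integrating factor of this inequality.
  set H : ℝ → ℝ := fun x => G x * Real.exp (N / x)
  have hH : ∀ x, 0 < x → HasDerivAt H (N * (besselJ n x * besselJ (n + 1) x) / x * Real.exp (N / x)
      + G x * (Real.exp (N / x) * (N * (-(x ^ 2)⁻¹)))) x := by
    intro x hx
    refine (hG x hx).mul (HasDerivAt.exp ?_)
    change HasDerivAt (fun y => N / y) _ _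
    simp only [div_eq_mul_inv]
    exact (hasDerivAt_inv hx.ne').const_mul N
  have hanti : AntitoneOn H (Ici N) := by
    refine antitoneOn_of_deriv_nonpos (convex_Ici N)
      (fun x hx => (hH x (hN0.trans_le hx)).continuousAt.continuousWithinAt)
      (fun x hx => ?_) (fun x hx => ?_)
    · rw [interior_Ici] at hx
      exact (hH x (hN0.trans hx)).differentiableAt.differentiableWithinAt
    · rw [interior_Ici] at hx
      have hx0 : 0 < x := hN0.trans hx
      rw [(hH x hx0).deriv]
      have e : N * (besselJ n x * besselJ (n + 1) x) / x * Real.exp (N / x)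
          + G x * (Real.exp (N / x) * (N * (-(x ^ 2)⁻¹))) =
          -(N * Real.exp (N / x) / x ^ 2 * (G x - x * (besselJ n x * besselJ (n + 1) x))) := by
        field_simp; ring
      rw [e, neg_nonpos]
      refine mul_nonneg (by positivity) ?_
      simp only [G]
      have hx' : N < x := hx
      nlinarith [mul_nonneg hN0.le (sq_nonneg (besselJ n x - besselJ (n + 1) x)),
        mul_nonneg hx0.le (sq_nonneg (besselJ n x - besselJ (n + 1) x)),
        mul_nonneg (sub_nonneg.2 hx'.le) (add_nonneg (sq_nonneg (besselJ n x))
        (sq_nonneg (besselJ (n + 1) x)))]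
  have hc : Continuous fun x => x * (besselJ n x ^ 2 + besselJ (n + 1) x ^ 2) :=
    continuous_id.mul (((continuous_besselJ n).pow 2).add ((continuous_besselJ (n + 1)).pow 2))
  obtain ⟨C, hC⟩ := (isCompact_Icc (a := (0 : ℝ)) (b := N)).exists_bound_of_continuousOn
    hc.continuousOn
  refine ⟨max C (2 * H N), fun x hx => ?_⟩
  rcases le_total x N with h | h
  · exact (le_abs_self _).trans ((hC x ⟨hx, h⟩).trans (le_max_left _ _))
  · refine (hGlow x h).trans (le_trans ?_ (le_max_right _ _))
    have h0 : 0 ≤ G x := by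
      have := hGlow x h
      have : 0 ≤ x * (besselJ n x ^ 2 + besselJ (n + 1) x ^ 2) := by positivity
      linarith
    have h1 : G x ≤ H x :=
      le_mul_of_one_le_right h0 (Real.one_le_exp (div_nonneg hN0.le (hN0.le.trans h)))
    have h2 : H x ≤ H N := hanti (mem_Ici.2 le_rfl) h h
    linarith

lemma exists_abs_besselJ_le_div_sqrt (n : ℕ) :
    ∃ C : ℝ, 0 < C ∧ ∀ x, 0 < x → |besselJ n x| ≤ C / √x := by
  obtain ⟨C, hC⟩ := exists_mul_sq_add_sq_besselJ_le n
  refine ⟨√(|C| + 1), by positivity, fun x hx => ?_⟩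
  rw [← Real.sqrt_div (by positivity)]
  refine Real.abs_le_sqrt ?_
  rw [le_div_iff₀ hx]
  have := hC x hx.le
  nlinarith [le_abs_self C, mul_nonneg hx.le (sq_nonneg (besselJ (n + 1) x))]

lemma exists_abs_besselJ_le (n : ℕ) : ∃ C : ℝ, 0 < C ∧ ∀ x, 0 ≤ x → |besselJ n x| ≤ C := by
  obtain ⟨C, hC0, hC⟩ := exists_abs_besselJ_le_div_sqrt n
  obtain ⟨D, hD⟩ := (isCompact_Icc (a := (0 : ℝ)) (b := 1)).exists_bound_of_continuousOn
    (continuous_besselJ n).continuousOn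
  refine ⟨max C D, lt_max_of_lt_left hC0, fun x hx => ?_⟩
  rcases le_total x 1 with h | h
  · exact (hD x ⟨hx, h⟩).trans (le_max_right _ _)
  · refine (hC x (one_pos.trans_le h)).trans (le_trans ?_ (le_max_left _ _))
    exact div_le_self hC0.le (Real.one_le_sqrt.2 h)

lemma exists_abs_besselJ_succ_le_mul (n : ℕ) :
    ∃ C : ℝ, 0 < C ∧ ∀ x, 0 ≤ x → |besselJ (n + 1) x| ≤ C * x := by
  obtain ⟨C, hC0, hC⟩ := exists_abs_besselJ_le (n + 1)
  have hc : Continuous fun x : ℝ => 1 / 2 * (x / 2) ^ n * besselSeries (n + 1) ((x / 2) ^ 2) :=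
    (by fun_prop : Continuous fun x : ℝ => 1 / 2 * (x / 2) ^ n).mul
      ((continuous_besselSeries (n + 1)).comp (by fun_prop))
  obtain ⟨D, hD⟩ := (isCompact_Icc (a := (0 : ℝ)) (b := 1)).exists_bound_of_continuousOn
    hc.continuousOn
  refine ⟨max C D, lt_max_of_lt_left hC0, fun x hx => ?_⟩
  rcases le_total x 1 with h | h
  · have := hD x ⟨hx, h⟩
    rw [besselJ_eq, pow_succ, show (x / 2) ^ n * (x / 2) * besselSeries (n + 1) ((x / 2) ^ 2) =
      (1 / 2 * (x / 2) ^ n * besselSeries (n + 1) ((x / 2) ^ 2)) * x by ring, abs_mul,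
      abs_of_nonneg hx]
    exact mul_le_mul_of_nonneg_right (this.trans (le_max_right _ _)) hx
  · calc |besselJ (n + 1) x| ≤ C := hC x hx
      _ ≤ max C D := le_max_left _ _
      _ ≤ max C D * x := le_mul_of_one_le_right (hC0.le.trans (le_max_left _ _)) h

/-! ### Majorants, absolute convergence and continuity at b = 1. -/

/-- The power `t^p` on `(0,1]` glued to `t^q` on `(1,∞)`; a convenient integrable majorant. -/
noncomputable def gluedRpow (p q t : ℝ) : ℝ := if t ≤ 1 then t ^ p else t ^ q

lemma integrableOn_gluedRpow {p q : ℝ} (hp : -1 < p) (hq : q < -1) :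
    IntegrableOn (gluedRpow p q) (Ioi 0) := by
  rw [← Ioc_union_Ioi_eq_Ioi (zero_le_one (α := ℝ))]
  refine IntegrableOn.union ?_ ?_
  · have h := (intervalIntegral.intervalIntegrable_rpow' (a := 0) (b := 1) hp).1
    refine h.congr_fun (fun t ht => ?_) measurableSet_Ioc
    simp [gluedRpow, ht.2]
  · refine (integrableOn_Ioi_rpow_of_lt hq one_pos).congr_fun (fun t ht => ?_) measurableSet_Ioi
    simp [gluedRpow, not_le.2 (mem_Ioi.1 ht)]

lemma continuousOn_lambdaIntegrand (α : ℝ) (n : ℕ) (b : ℝ) :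
    ContinuousOn (lambdaIntegrand α n b) (Ioi 0) := by
  refine ContinuousOn.div ?_ ?_ fun t ht => (Real.rpow_pos_of_pos ht _).ne'
  · exact (((continuous_besselJ n).comp (by fun_prop)).mul (continuous_besselJ n)).continuousOn
  · exact continuousOn_id.rpow_const fun t ht => Or.inl (ne_of_gt ht)

lemma exists_abs_mul_besselJ_le (m n : ℕ) : ∃ C : ℝ, 0 < C ∧ ∀ b t : ℝ, 0 < b → 0 < t →
    |besselJ m (b * t) * besselJ n t| ≤ C / (√b * t) := by
  obtain ⟨C, hC0, hC⟩ := exists_abs_besselJ_le_div_sqrt m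
  obtain ⟨D, hD0, hD⟩ := exists_abs_besselJ_le_div_sqrt n
  refine ⟨C * D, by positivity, fun b t hb ht => ?_⟩
  rw [abs_mul]
  refine (mul_le_mul (hC _ (mul_pos hb ht)) (hD t ht) (abs_nonneg _) (by positivity)).trans_eq ?_
  rw [div_mul_div_comm, Real.sqrt_mul hb.le, mul_assoc, Real.mul_self_sqrt ht.le]

/-- A majorant of the integrand, uniform in `b ≥ c`. -/
lemma exists_abs_lambdaIntegrand_le (n : ℕ) {c : ℝ} (hc : 0 < c) : ∃ C : ℝ, 0 < C ∧
    ∀ α b t : ℝ, c ≤ b → 0 < t → |lambdaIntegrand α n b t| ≤ C * gluedRpow (α - 1) (α - 2) t := by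
  obtain ⟨C, hC0, hC⟩ := exists_abs_besselJ_le n
  obtain ⟨D, hD0, hD⟩ := exists_abs_mul_besselJ_le n n
  refine ⟨max (C * C) (D / √c), lt_max_of_lt_left (by positivity), fun α b t hb ht => ?_⟩
  have hb0 := hc.trans_le hb
  have hr : 0 < t ^ (1 - α) := Real.rpow_pos_of_pos ht _
  rw [lambdaIntegrand, abs_div, abs_of_pos hr, gluedRpow]
  split_ifs with h
  · rw [show α - 1 = -(1 - α) by ring, Real.rpow_neg ht.le, ← div_eq_mul_inv]
    refine div_le_div_of_nonneg_right (le_trans ?_ (le_max_left _ _)) hr.le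
    rw [abs_mul]
    exact mul_le_mul (hC _ (by positivity)) (hC _ ht.le) (abs_nonneg _) hC0.le
  · have e : t ^ (α - 2) = t⁻¹ / t ^ (1 - α) := by
      rw [show α - 2 = -1 - (1 - α) by ring, Real.rpow_sub ht, Real.rpow_neg_one]
    rw [e, ← mul_div_assoc]
    refine div_le_div_of_nonneg_right ((hD b t hb0 ht).trans ?_) hr.le
    rw [← div_div, ← div_eq_mul_inv]
    refine div_le_div_of_nonneg_right (le_trans ?_ (le_max_right _ _)) ht.le
    exact div_le_div_of_nonneg_left hD0.le (Real.sqrt_pos.2 hc) (Real.sqrt_le_sqrt hb)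

lemma integrableOn_lambdaIntegrand {α : ℝ} (h0 : 0 < α) (h1 : α < 1) (n : ℕ) {b : ℝ} (hb : 0 < b) :
    IntegrableOn (lambdaIntegrand α n b) (Ioi 0) := by
  obtain ⟨C, -, hC⟩ := exists_abs_lambdaIntegrand_le n hb
  refine Integrable.mono' ((integrableOn_gluedRpow (p := α - 1) (q := α - 2) (by linarith)
    (by linarith)).const_mul C)
    ((continuousOn_lambdaIntegrand α n b).aestronglyMeasurable measurableSet_Ioi) ?_
  filter_upwards [ae_restrict_mem measurableSet_Ioi] with t ht
  exact hC α b t le_rfl ht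

/-- Continuity of the integral as `b → 1⁻`. -/
lemma tendsto_integral_lambdaIntegrand {α : ℝ} (h0 : 0 < α) (h1 : α < 1) (n : ℕ) :
    Tendsto (fun b => ∫ t in Ioi (0 : ℝ), lambdaIntegrand α n b t) (𝓝[<] 1)
      (𝓝 (∫ t in Ioi (0 : ℝ), lambdaIntegrand α n 1 t)) := by
  obtain ⟨C, -, hC⟩ := exists_abs_lambdaIntegrand_le n (c := 1 / 2) (by norm_num)
  refine tendsto_integral_filter_of_dominated_convergence
    (fun t => C * gluedRpow (α - 1) (α - 2) t) ?_ ?_ ?_ ?_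
  · exact Eventually.of_forall fun b =>
      (continuousOn_lambdaIntegrand α n b).aestronglyMeasurable measurableSet_Ioi
  · have : ∀ᶠ b : ℝ in 𝓝[<] 1, 1 / 2 ≤ b :=
      nhdsWithin_le_nhds (Ici_mem_nhds (by norm_num))
    filter_upwards [this] with b hb
    filter_upwards [ae_restrict_mem measurableSet_Ioi] with t ht
    exact hC α b t hb ht
  · exact (integrableOn_gluedRpow (by linarith) (by linarith)).const_mul C
  · refine Eventually.of_forall fun t => ?_
    have : Continuous fun b => lambdaIntegrand α n b t :=
      (((continuous_besselJ n).comp (by fun_prop : Continuous fun b : ℝ => b * t)).mul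
        continuous_const).div_const _
    exact (this.tendsto 1).mono_left nhdsWithin_le_nhds

/-! ### Weber's second exponential integral. -/

/-- `besselISeries n z = I_n(2z)`, with `I_n` the modified Bessel function. -/
noncomputable def besselISeries (n : ℕ) (z : ℝ) : ℝ :=
  ∑' m : ℕ, z ^ (n + 2 * m) / ((m.factorial : ℝ) * ((n + m).factorial : ℝ))

/-- The coefficients of the double series of Weber's second exponential integral. -/
noncomputable def weberCoeff (n j k : ℕ) : ℝ :=
  (-1) ^ (j + k) * ((n + j + k).factorial : ℝ) /
    ((j.factorial : ℝ) * ((n + j).factorial : ℝ) * ((k.factorial : ℝ) * ((n + k).factorial : ℝ)))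

lemma factorial_cast_ne_zero (m : ℕ) : (m.factorial : ℝ) ≠ 0 :=
  Nat.cast_ne_zero.2 (Nat.factorial_ne_zero m)

lemma summable_pow_div_factorial_mul (n : ℕ) (z : ℝ) :
    Summable fun m : ℕ => z ^ m / ((m.factorial : ℝ) * ((n + m).factorial : ℝ)) := by
  refine Summable.of_norm_bounded (summable_besselSeries n (-|z|)).abs fun m => ?_
  simp only [Real.norm_eq_abs, abs_mul, abs_div, abs_pow, abs_neg, abs_one, one_pow, abs_abs]
  exact le_of_eq (by ring)

/-- Vandermonde's identity for j + (n + k). -/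
lemma sum_choose_mul_choose (n j k : ℕ) :
    ∑ m ∈ Finset.range (k + 1), (j.choose m : ℝ) * ((n + k).choose (k - m) : ℝ)
      = ((n + j + k).choose k : ℝ) := by
  have := Nat.add_choose_eq j (n + k) k
  rw [Finset.Nat.sum_antidiagonal_eq_sum_range_succ_mk] at this
  rw [show n + j + k = j + (n + k) by ring, this]
  push_cast
  rfl

/-- In the exponents j = m + i and k = m + l, the factorials regroup into a product of binomials
that Vandermonde can sum over m. -/
lemma weber_term_eq (n i l m : ℕ) (x y : ℝ) :
    (-x) ^ i / (i.factorial : ℝ) * ((-y) ^ l / (l.factorial : ℝ)) *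
      ((x * y) ^ m / ((m.factorial : ℝ) * ((n + m).factorial : ℝ))) =
    (-1) ^ (m + i + (m + l)) * (x ^ (m + i) * y ^ (m + l)) /
      (((m + i).factorial : ℝ) * ((n + (m + l)).factorial : ℝ)) *
        (((m + i).choose m : ℝ) * ((n + (m + l)).choose l : ℝ)) := by
  rw [Nat.cast_add_choose, show n + (m + l) = l + (n + m) by ring, Nat.cast_add_choose]
  have := factorial_cast_ne_zero i
  have := factorial_cast_ne_zero l
  have := factorial_cast_ne_zero m
  have := factorial_cast_ne_zero (n + m)
  have := factorial_cast_ne_zero (m + i)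
  have := factorial_cast_ne_zero (l + (n + m))
  have hsgn : (-1 : ℝ) ^ (m + i + (m + l)) = (-1) ^ i * (-1) ^ l := by
    rw [show m + i + (m + l) = i + l + 2 * m by ring, pow_add, pow_add, pow_mul]; simp
  rw [hsgn, neg_pow x, neg_pow y, mul_pow, pow_add, pow_add]
  field_simp

/-- The triple series behind Weber's second exponential integral, indexed by the exponents of `x`
and `y` and the index of the modified Bessel series. -/
noncomputable def weberTerm (n : ℕ) (x y : ℝ) (q : (ℕ × ℕ) × ℕ) : ℝ :=
  if q.2 ≤ q.1.1 ∧ q.2 ≤ q.1.2 then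
    (-x) ^ (q.1.1 - q.2) / ((q.1.1 - q.2).factorial : ℝ) *
    ((-y) ^ (q.1.2 - q.2) / ((q.1.2 - q.2).factorial : ℝ)) *
    ((x * y) ^ q.2 / ((q.2.factorial : ℝ) * ((n + q.2).factorial : ℝ))) else 0

lemma hasSum_mul_prod {ι κ : Type*} {f : ι → ℝ} {g : κ → ℝ} {a b : ℝ} (hf : HasSum f a)
    (hg : HasSum g b) : HasSum (fun q : ι × κ => f q.1 * g q.2) (a * b) :=
  hf.mul hg (summable_mul_of_summable_norm hf.summable.norm hg.summable.norm)

lemma hasSum_pow_div_factorial (z : ℝ) :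
    HasSum (fun i : ℕ => z ^ i / (i.factorial : ℝ)) (Real.exp z) := by
  rw [Real.exp_eq_exp_ℝ]; exact NormedSpace.expSeries_div_hasSum_exp z

/-- A product of three absolutely convergent series, moved along the injection (i, l, m) ↦ (m + i, m
+ l, m); the term is zero off its range. -/
lemma hasSum_weberTerm (n : ℕ) (x y : ℝ) :
    HasSum (weberTerm n x y) (Real.exp (-x) * Real.exp (-y) *
        ∑' m : ℕ, (x * y) ^ m / ((m.factorial : ℝ) * ((n + m).factorial : ℝ))) := by
  have hT := hasSum_mul_prod (hasSum_mul_prod (hasSum_pow_div_factorial (-x))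
    (hasSum_pow_div_factorial (-y))) (summable_pow_div_factorial_mul n (x * y)).hasSum
  let e : (ℕ × ℕ) × ℕ → (ℕ × ℕ) × ℕ := fun q => ((q.1.1 + q.2, q.1.2 + q.2), q.2)
  have hinj : Function.Injective e := by
    rintro ⟨⟨i, l⟩, m⟩ ⟨⟨i', l'⟩, m'⟩ h
    simp only [e, Prod.mk.injEq] at h
    simp only [Prod.mk.injEq]
    omega
  have hcomp : weberTerm n x y ∘ e = fun q : (ℕ × ℕ) × ℕ =>
      (-x) ^ q.1.1 / (q.1.1.factorial : ℝ) * ((-y) ^ q.1.2 / (q.1.2.factorial : ℝ)) *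
        ((x * y) ^ q.2 / ((q.2.factorial : ℝ) * ((n + q.2).factorial : ℝ))) := by
    funext q
    simp [weberTerm, e]
  have hzero : ∀ q ∉ range e, weberTerm n x y q = 0 := by
    rintro ⟨⟨j, k⟩, m⟩ hq
    rw [weberTerm, if_neg]
    rintro ⟨h1, h2⟩
    simp only at h1 h2
    exact hq ⟨((j - m, k - m), m), by
      simp only [e, Nat.sub_add_cancel h1, Nat.sub_add_cancel h2]⟩
  rw [← hinj.hasSum_iff hzero, hcomp]
  exact hT

lemma hasSum_weberTerm_fiber (n : ℕ) (x y : ℝ) (j k : ℕ) :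
    HasSum (fun m => weberTerm n x y ((j, k), m)) (weberCoeff n j k * (x ^ j * y ^ k)) := by
  have hfin : ∀ m ∉ Finset.range (k + 1), weberTerm n x y ((j, k), m) = 0 := by
    intro m hm
    rw [Finset.mem_range] at hm
    rw [weberTerm, if_neg]
    simp only
    omega
  have hterm : ∀ m ∈ Finset.range (k + 1), weberTerm n x y ((j, k), m) =
      (-1) ^ (j + k) * (x ^ j * y ^ k) / ((j.factorial : ℝ) * ((n + k).factorial : ℝ)) *
        ((j.choose m : ℝ) * ((n + k).choose (k - m) : ℝ)) := by
    intro m hm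
    rw [Finset.mem_range] at hm
    simp only [weberTerm]
    split_ifs with h
    · obtain ⟨h1, h2⟩ := h
      obtain ⟨i, rfl⟩ := Nat.exists_eq_add_of_le h1
      obtain ⟨l, rfl⟩ := Nat.exists_eq_add_of_le h2
      simp only [Nat.add_sub_cancel_left]
      exact weber_term_eq n i l m x y
    -- Here m ≤ k, so the term was set to zero because j < m, and the binomial vanishes as well.
    · have : j < m := by omega
      rw [Nat.choose_eq_zero_of_lt this]; simp
  have hsum : HasSum _ _ (SummationFilter.unconditional ℕ) := hasSum_sum_of_ne_finset_zero hfin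
  rw [Finset.sum_congr rfl hterm, ← Finset.mul_sum, sum_choose_mul_choose,
    show n + j + k = k + (n + j) by ring, Nat.cast_add_choose] at hsum
  convert hsum using 1
  rw [weberCoeff, show n + j + k = k + (n + j) by ring]
  have := factorial_cast_ne_zero j
  have := factorial_cast_ne_zero k
  have := factorial_cast_ne_zero (n + j)
  have := factorial_cast_ne_zero (n + k)
  field_simp

/-- Double series form of `e^{-x-y} I_n(2√(xy)) / (xy)^{n/2}`. -/
lemma hasSum_weberCoeff (n : ℕ) (x y : ℝ) :
    HasSum (fun q : ℕ × ℕ => weberCoeff n q.1 q.2 * (x ^ q.1 * y ^ q.2))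
      (Real.exp (-x) * Real.exp (-y) *
        ∑' m : ℕ, (x * y) ^ m / ((m.factorial : ℝ) * ((n + m).factorial : ℝ))) :=
  (hasSum_weberTerm n x y).prod_fiberwise fun q => hasSum_weberTerm_fiber n x y q.1 q.2

lemma integral_pow_mul_exp_neg_sq_div {u : ℝ} (hu : 0 < u) (m : ℕ) :
    ∫ t in Ioi (0 : ℝ), t ^ (2 * m + 1) * Real.exp (-(t ^ 2 / (4 * u)))
      = m.factorial * (4 * u) ^ (m + 1) / 2 := by
  have h := integral_rpow_mul_exp_neg_mul_rpow (p := 2) (q := 2 * m + 1) (b := (4 * u)⁻¹)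
    two_pos (by linarith [(Nat.cast_nonneg m : (0 : ℝ) ≤ m)]) (by positivity)
  have e1 : (2 * (m : ℝ) + 1 + 1) / 2 = m + 1 := by ring
  have e2 : -(2 * (m : ℝ) + 1 + 1) / 2 = -((m + 1 : ℕ) : ℝ) := by push_cast; ring
  rw [e1, e2, Real.Gamma_nat_eq_factorial, Real.rpow_neg (by positivity), Real.rpow_natCast,
    inv_pow, inv_inv] at h
  rw [show (m.factorial : ℝ) * (4 * u) ^ (m + 1) / 2 =
    (4 * u) ^ (m + 1) * (1 / 2) * m.factorial by ring, ← h]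
  refine setIntegral_congr_fun measurableSet_Ioi fun t _ => ?_
  have e3 : t ^ (2 * (m : ℝ) + 1) = t ^ (2 * m + 1) := by
    rw [← Real.rpow_natCast]; push_cast; rfl
  have e4 : t ^ (2 : ℝ) = t ^ 2 := by rw [← Real.rpow_natCast]; norm_num
  simp only [e3, e4]
  congr 2
  field_simp

lemma integrableOn_pow_mul_exp_neg_sq_div {u : ℝ} (hu : 0 < u) (m : ℕ) :
    IntegrableOn (fun t => t ^ (2 * m + 1) * Real.exp (-(t ^ 2 / (4 * u)))) (Ioi (0 : ℝ)) := by
  -- A non-integrable function has Bochner integral 0, so a nonzero value proves integrability. The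
  -- same device is used for the other kernels below.
  refine not_imp_comm.1 integral_undef ?_
  rw [integral_pow_mul_exp_neg_sq_div hu]
  have := factorial_cast_ne_zero m
  positivity

lemma hasSum_mul_besselJ (n : ℕ) (x y : ℝ) :
    HasSum (fun q : ℕ × ℕ => (-1 : ℝ) ^ q.1 / ((q.1.factorial : ℝ) * ((n + q.1).factorial : ℝ)) *
      (x / 2) ^ (2 * q.1 + n) * ((-1 : ℝ) ^ q.2 / ((q.2.factorial : ℝ) * ((n + q.2).factorial : ℝ)) *
      (y / 2) ^ (2 * q.2 + n))) (besselJ n x * besselJ n y) := by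
  have h : ∀ x, HasSum (fun k : ℕ => (-1 : ℝ) ^ k / ((k.factorial : ℝ) * ((n + k).factorial : ℝ)) *
      (x / 2) ^ (2 * k + n)) (besselJ n x) := fun x => by
    refine Summable.hasSum (((summable_besselSeries n ((x / 2) ^ 2)).mul_right
      ((x / 2) ^ n)).congr fun k => ?_)
    rw [pow_add, pow_mul]; ring
  exact hasSum_mul_prod (h x) (h y)

/-- Weber's second exponential integral. -/
lemma integral_mul_exp_mul_besselJ (n : ℕ) (b : ℝ) {u : ℝ} (hu : 0 < u) :
    ∫ t in Ioi (0 : ℝ), t * Real.exp (-(t ^ 2 / (4 * u))) * (besselJ n t * besselJ n (b * t))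
      = 2 * u * (Real.exp (-u) * Real.exp (-(b ^ 2 * u))) * besselISeries n (b * u) := by
  set C : ℕ × ℕ → ℝ := fun q =>
    (-1 : ℝ) ^ q.1 / ((q.1.factorial : ℝ) * ((n + q.1).factorial : ℝ)) * (1 / 2) ^ (2 * q.1 + n) *
    ((-1 : ℝ) ^ q.2 / ((q.2.factorial : ℝ) * ((n + q.2).factorial : ℝ)) *
      (b / 2) ^ (2 * q.2 + n)) with hC
  set F : ℕ × ℕ → ℝ → ℝ := fun q t =>
    C q * (t ^ (2 * (n + q.1 + q.2) + 1) * Real.exp (-(t ^ 2 / (4 * u)))) with hF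
  have hint : ∀ q, ∫ t in Ioi (0 : ℝ), F q t =
      2 * u * (b * u) ^ n * (weberCoeff n q.1 q.2 * (u ^ q.1 * (b ^ 2 * u) ^ q.2)) := by
    rintro ⟨j, k⟩
    simp only [hF, hC]
    rw [integral_const_mul, integral_pow_mul_exp_neg_sq_div hu, weberCoeff]
    have := factorial_cast_ne_zero j
    have := factorial_cast_ne_zero k
    have := factorial_cast_ne_zero (n + j)
    have := factorial_cast_ne_zero (n + k)
    have h4 : (4 : ℝ) ^ (n + j + k + 1) = 2 ^ (2 * j + n) * 2 ^ (2 * k + n) * 4 := by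
      rw [show (4 : ℝ) = 2 ^ 2 by norm_num, ← pow_mul, ← pow_add, ← pow_add]; congr 1; ring
    rw [mul_pow 4 u, h4, div_pow b, div_pow 1]
    field_simp
    ring
  have hsum := hasSum_weberCoeff n u (b ^ 2 * u)
  -- Each term has constant sign on (0, ∞), so its L¹ norm is the absolute value of its integral,
  -- and these are summable by `hasSum_weberCoeff`.
  have hnorm : ∀ q, ∫ t in Ioi (0 : ℝ), ‖F q t‖ =
      |2 * u * (b * u) ^ n * (weberCoeff n q.1 q.2 * (u ^ q.1 * (b ^ 2 * u) ^ q.2))| := by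
    intro q
    have : ∀ t ∈ Ioi (0 : ℝ), ‖F q t‖ =
        |C q| * (t ^ (2 * (n + q.1 + q.2) + 1) * Real.exp (-(t ^ 2 / (4 * u)))) := by
      intro t ht
      have ht' : (0 : ℝ) < t := ht
      simp only [hF, Real.norm_eq_abs]
      rw [abs_mul, abs_of_pos (by positivity : 0 <
        t ^ (2 * (n + q.1 + q.2) + 1) * Real.exp (-(t ^ 2 / (4 * u))))]
    rw [setIntegral_congr_fun measurableSet_Ioi this, ← hint q]
    simp only [hF]
    rw [integral_const_mul, integral_const_mul, integral_pow_mul_exp_neg_sq_div hu, abs_mul (C q),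
      abs_of_pos (by positivity : 0 < ((n + q.1 + q.2).factorial : ℝ) *
        (4 * u) ^ (n + q.1 + q.2 + 1) / 2)]
  have key := hasSum_integral_of_summable_integral_norm (μ := volume.restrict (Ioi (0 : ℝ)))
    (F := F) (fun q => (integrableOn_pow_mul_exp_neg_sq_div hu _).const_mul (C q))
    (by simp only [hnorm]; exact (hsum.summable.mul_left _).abs)
  simp only [hint] at key
  have heq := key.unique (hsum.mul_left (2 * u * (b * u) ^ n))
  have hL : ∫ t in Ioi (0 : ℝ), t * Real.exp (-(t ^ 2 / (4 * u))) *
      (besselJ n t * besselJ n (b * t)) = ∫ t in Ioi (0 : ℝ), ∑' q, F q t := by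
    refine setIntegral_congr_fun measurableSet_Ioi fun t _ => ?_
    rw [← ((hasSum_mul_besselJ n t (b * t)).mul_left
      (t * Real.exp (-(t ^ 2 / (4 * u))))).tsum_eq]
    refine tsum_congr fun q => ?_
    simp only [hF, hC]
    rw [show t / 2 = 1 / 2 * t by ring, show b * t / 2 = b / 2 * t by ring, mul_pow, mul_pow]
    ring
  rw [hL, heq, besselISeries]
  have : ∀ m : ℕ, (b * u) ^ (n + 2 * m) / ((m.factorial : ℝ) * ((n + m).factorial : ℝ)) =
      (b * u) ^ n * ((u * (b ^ 2 * u)) ^ m / ((m.factorial : ℝ) * ((n + m).factorial : ℝ))) := by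
    intro m
    rw [pow_add, pow_mul, show (b * u) ^ 2 = u * (b ^ 2 * u) by ring]; ring
  simp only [this, tsum_mul_left]
  ring

/-! ### From the product of J_n to an integral of I_n. -/

/-- The kernel producing the power `t^{2s-2}`. -/
lemma integral_rpow_mul_exp_neg_div {s t : ℝ} (hs : s < 1) (ht : 0 < t) :
    ∫ u in Ioi (0 : ℝ), u ^ (s - 2) * Real.exp (-(t ^ 2 / (4 * u))) =
      Real.Gamma (1 - s) * 4 ^ (1 - s) * t ^ (2 * s - 2) := by
  -- The substitution u ↦ 1/u turns the integral into a Gamma integral.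
  have h1 := integral_comp_rpow_Ioi (fun u : ℝ => u ^ (s - 2) * Real.exp (-(t ^ 2 / (4 * u))))
    (p := -1) (by norm_num)
  have h2 := Real.integral_rpow_mul_exp_neg_mul_Ioi (a := 1 - s) (r := t ^ 2 / 4) (by linarith)
    (by positivity)
  rw [← h1]
  have h3 : ∀ x ∈ Ioi (0 : ℝ), (|(-1 : ℝ)| * x ^ ((-1 : ℝ) - 1)) •
      ((x ^ (-1 : ℝ)) ^ (s - 2) * Real.exp (-(t ^ 2 / (4 * x ^ (-1 : ℝ))))) =
      x ^ (1 - s - 1) * Real.exp (-(t ^ 2 / 4 * x)) := by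
    intro x hx
    have hx' : (0 : ℝ) < x := hx
    rw [← Real.rpow_mul hx'.le, smul_eq_mul, abs_neg, abs_one, one_mul, ← mul_assoc,
      ← Real.rpow_add hx', Real.rpow_neg_one]
    congr 2
    · ring
    · field_simp
  rw [setIntegral_congr_fun measurableSet_Ioi h3, h2, one_div_div,
    Real.div_rpow (by norm_num) (by positivity), ← Real.rpow_natCast, ← Real.rpow_mul ht.le,
    show 2 * s - 2 = -(((2 : ℕ) : ℝ) * (1 - s)) by push_cast; ring, Real.rpow_neg ht.le]
  ring

/-- Insert the Gaussian superposition for t^(2s-2) and swap: the inner t-integral is Weber's. Since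
the kernel is positive, the hypothesis of Fubini reduces to absolute integrability of
`lambdaIntegrand`. -/
lemma integral_lambdaIntegrand_eq_besselISeries {s : ℝ} (h0 : 0 < s) (h1 : s < 1 / 2) (n : ℕ)
    {b : ℝ} (hb : 0 < b) :
    ∫ t in Ioi (0 : ℝ), lambdaIntegrand (2 * s) n b t = 2 ^ (2 * s - 1) / Real.Gamma (1 - s) *
      ∫ u in Ioi (0 : ℝ), u ^ (s - 1) * (Real.exp (-u) * Real.exp (-(b ^ 2 * u))) *
        besselISeries n (b * u) := by
  have hG : 0 < Real.Gamma (1 - s) := Real.Gamma_pos_of_pos (by linarith)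
  set K : ℝ → ℝ → ℝ := fun t u => u ^ (s - 2) * Real.exp (-(t ^ 2 / (4 * u))) with hK
  set A : ℝ → ℝ := fun t => t * (besselJ n t * besselJ n (b * t)) with hA
  have hKint : ∀ t ∈ Ioi (0 : ℝ), IntegrableOn (K t) (Ioi 0) := by
    intro t ht
    have ht' : (0 : ℝ) < t := ht
    refine not_imp_comm.1 integral_undef ?_
    rw [integral_rpow_mul_exp_neg_div (by linarith) ht]
    positivity
  have hAL : ∀ t ∈ Ioi (0 : ℝ), A t * (Real.Gamma (1 - s) * 4 ^ (1 - s) * t ^ (2 * s - 2)) =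
      Real.Gamma (1 - s) * 4 ^ (1 - s) * lambdaIntegrand (2 * s) n b t := by
    intro t ht
    have ht' : (0 : ℝ) < t := ht
    simp only [hA, lambdaIntegrand]
    have : t * t ^ (2 * s - 2) = (t ^ (1 - 2 * s))⁻¹ := by
      rw [← Real.rpow_neg ht'.le, mul_comm, ← Real.rpow_add_one ht'.ne']; congr 1; ring
    rw [div_eq_mul_inv, ← this]; ring
  have hmeas : AEStronglyMeasurable (fun q : ℝ × ℝ => A q.1 * K q.1 q.2)
      ((volume.restrict (Ioi (0 : ℝ))).prod (volume.restrict (Ioi (0 : ℝ)))) := by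
    rw [Measure.prod_restrict]
    refine ContinuousOn.aestronglyMeasurable ?_ (measurableSet_Ioi.prod measurableSet_Ioi)
    have hAc : Continuous A := continuous_id.mul ((continuous_besselJ n).mul
      ((continuous_besselJ n).comp (by fun_prop)))
    refine (hAc.comp continuous_fst).continuousOn.mul (ContinuousOn.mul ?_ ?_)
    · exact continuous_snd.continuousOn.rpow_const fun q hq => Or.inl (ne_of_gt hq.2)
    · refine Real.continuous_exp.comp_continuousOn (ContinuousOn.neg (ContinuousOn.div
        (by fun_prop) (by fun_prop) fun q hq => ?_))
      have : (0 : ℝ) < q.2 := hq.2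
      positivity
  have hint : Integrable (fun q : ℝ × ℝ => A q.1 * K q.1 q.2)
      ((volume.restrict (Ioi (0 : ℝ))).prod (volume.restrict (Ioi (0 : ℝ)))) := by
    rw [integrable_prod_iff hmeas]
    constructor
    · filter_upwards [ae_restrict_mem measurableSet_Ioi] with t ht
      exact (hKint t ht).const_mul _
    · have := ((integrableOn_lambdaIntegrand (α := 2 * s) (by linarith) (by linarith) n hb).const_mul
        (Real.Gamma (1 - s) * 4 ^ (1 - s))).norm
      refine this.congr ?_
      filter_upwards [ae_restrict_mem measurableSet_Ioi] with t ht
      have ht' : (0 : ℝ) < t := ht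
      rw [← hAL t ht]
      have : ∀ u ∈ Ioi (0 : ℝ), ‖A t * K t u‖ = ‖A t‖ * K t u := by
        intro u hu
        have hu' : (0 : ℝ) < u := hu
        rw [norm_mul, Real.norm_of_nonneg (by simp only [hK]; positivity : 0 ≤ K t u)]
      rw [setIntegral_congr_fun measurableSet_Ioi this, integral_const_mul, hK,
        integral_rpow_mul_exp_neg_div (by linarith) ht, norm_mul,
        Real.norm_of_nonneg (by positivity :
          0 ≤ Real.Gamma (1 - s) * 4 ^ (1 - s) * t ^ (2 * s - 2))]
  have hswap := integral_integral_swap (f := fun t u => A t * K t u) hint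
  have hleft : ∫ t in Ioi (0 : ℝ), ∫ u in Ioi (0 : ℝ), A t * K t u =
      Real.Gamma (1 - s) * 4 ^ (1 - s) * ∫ t in Ioi (0 : ℝ), lambdaIntegrand (2 * s) n b t := by
    rw [← integral_const_mul]
    refine setIntegral_congr_fun measurableSet_Ioi fun t ht => ?_
    rw [integral_const_mul, ← hAL t ht, hK, integral_rpow_mul_exp_neg_div (by linarith) ht]
  have hright : ∫ u in Ioi (0 : ℝ), ∫ t in Ioi (0 : ℝ), A t * K t u =
      2 * ∫ u in Ioi (0 : ℝ), u ^ (s - 1) * (Real.exp (-u) * Real.exp (-(b ^ 2 * u))) *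
        besselISeries n (b * u) := by
    rw [← integral_const_mul]
    refine setIntegral_congr_fun measurableSet_Ioi fun u hu => ?_
    have hu' : (0 : ℝ) < u := hu
    have e : ∀ t, A t * K t u = u ^ (s - 2) *
        (t * Real.exp (-(t ^ 2 / (4 * u))) * (besselJ n t * besselJ n (b * t))) := fun t => by
      simp only [hA, hK]; ring
    simp only [e]
    rw [integral_const_mul, integral_mul_exp_mul_besselJ n b hu',
      show s - 1 = s - 2 + 1 by ring, Real.rpow_add_one hu'.ne']
    ring
  rw [hleft, hright] at hswap
  have h4 : (4 : ℝ) ^ (1 - s) * 2 ^ (2 * s - 1) = 2 := by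
    rw [show (4 : ℝ) = 2 ^ (2 : ℝ) by norm_num, ← Real.rpow_mul (by norm_num),
      ← Real.rpow_add (by norm_num)]
    ring_nf
    simp
  rw [div_mul_eq_mul_div, eq_div_iff hG.ne']
  have h40 : (0 : ℝ) < 4 ^ (1 - s) := by positivity
  refine mul_left_cancel₀ h40.ne' ?_
  rw [← mul_assoc ((4 : ℝ) ^ (1 - s)) (2 ^ (2 * s - 1)), h4, ← hswap]
  ring

/-! ### Fourier coefficients of |f|² and the binomial series. -/

lemma hasSum_mul_prod_complex {ι κ : Type*} {f : ι → ℂ} {g : κ → ℂ} {a b : ℂ} (hf : HasSum f a)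
    (hg : HasSum g b) : HasSum (fun q : ι × κ => f q.1 * g q.2) (a * b) :=
  hf.mul hg (summable_mul_of_summable_norm hf.summable.norm hg.summable.norm)

lemma integral_cos_int_mul (m : ℤ) :
    ∫ θ in (0 : ℝ)..2 * Real.pi, Real.cos (m * θ) = if m = 0 then 2 * Real.pi else 0 := by
  split_ifs with h
  · simp [h]
  · have hm : (m : ℝ) ≠ 0 := Int.cast_ne_zero.2 h
    rw [intervalIntegral.integral_comp_mul_left _ hm, integral_cos,
      show (m : ℝ) * (2 * Real.pi) = (2 * m : ℤ) * Real.pi by push_cast; ring, Real.sin_int_mul_pi]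
    simp

/-- The Fourier coefficients of `|f(e^{iθ})|²`, for `f(z) = ∑ a_k z^k` with real coefficients. -/
lemma hasSum_integral_norm_sq_mul_cos {a : ℕ → ℝ} (ha : Summable a) {f : ℂ → ℂ}
    (hf : ∀ z : ℂ, ‖z‖ = 1 → HasSum (fun k => (a k : ℂ) * z ^ k) (f z)) (n : ℕ) :
    HasSum (fun k => 2 * Real.pi * (a (n + k) * a k))
      (∫ θ in (0 : ℝ)..2 * Real.pi, ‖f (Complex.exp (θ * Complex.I))‖ ^ 2 * Real.cos (n * θ)) := by
  set F : ℕ × ℕ → ℝ → ℝ := fun q θ =>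
    a q.1 * a q.2 * Real.cos (((q.1 : ℤ) - (q.2 : ℤ) - (n : ℤ) : ℤ) * θ) with hF
  have hsum2 : Summable fun q : ℕ × ℕ => |a q.1 * a q.2| :=
    (hasSum_mul_prod ha.hasSum ha.hasSum).summable.abs
  have hpt : ∀ θ : ℝ, HasSum (fun q => F q θ)
      (‖f (Complex.exp (θ * Complex.I))‖ ^ 2 * Real.cos (n * θ)) := by
    intro θ
    set z := Complex.exp (θ * Complex.I) with hz
    have hz1 : ‖z‖ = 1 := Complex.norm_exp_ofReal_mul_I θ
    have h1 := hf z hz1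
    have h2 : HasSum (fun k => (a k : ℂ) * (starRingEnd ℂ z) ^ k) (starRingEnd ℂ (f z)) := by
      have := Complex.hasSum_conj'.2 h1
      simpa using this
    have h3 := hasSum_mul_prod_complex h1 h2
    have h4 := Complex.hasSum_re (h3.mul_right (Complex.exp ((-(n * θ) : ℝ) * Complex.I)))
    convert h4 using 1
    · funext q
      have hconj : starRingEnd ℂ z = Complex.exp ((-θ : ℝ) * Complex.I) := by
        rw [hz, ← Complex.exp_conj]; simp
      rw [hconj, hz, ← Complex.exp_nat_mul, ← Complex.exp_nat_mul,
        show ∀ x y : ℂ, (a q.1 : ℂ) * x * ((a q.2 : ℂ) * y) *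
          Complex.exp ((-(n * θ) : ℝ) * Complex.I) =
          ((a q.1 * a q.2 : ℝ) : ℂ) * (x * y * Complex.exp ((-(n * θ) : ℝ) * Complex.I)) from
          fun x y => by push_cast; ring,
        ← Complex.exp_add, ← Complex.exp_add, Complex.re_ofReal_mul,
        show (q.1 : ℂ) * (θ * Complex.I) + q.2 * ((-θ : ℝ) * Complex.I) +
          (-(n * θ) : ℝ) * Complex.I = ((((q.1 : ℤ) - (q.2 : ℤ) - (n : ℤ) : ℤ) * θ : ℝ) : ℂ) *
          Complex.I by push_cast; ring, Complex.exp_ofReal_mul_I_re]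
    · rw [Complex.mul_conj, Complex.re_ofReal_mul, Complex.exp_ofReal_mul_I_re, Real.cos_neg,
        Complex.normSq_eq_norm_sq]
  have key : HasSum (fun q => ∫ θ in (0 : ℝ)..2 * Real.pi, F q θ)
      (∫ θ in (0 : ℝ)..2 * Real.pi,
        ‖f (Complex.exp (θ * Complex.I))‖ ^ 2 * Real.cos (n * θ)) := by
    refine intervalIntegral.hasSum_integral_of_dominated_convergence
      (fun q _ => |a q.1 * a q.2|) (fun q => ?_) (fun q => ?_) ?_ ?_ ?_
    · exact (by fun_prop : Continuous (F q)).aestronglyMeasurable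
    · refine Eventually.of_forall fun θ _ => ?_
      simp only [hF, norm_mul, Real.norm_eq_abs, abs_mul]
      exact mul_le_of_le_one_right (by positivity) (Real.abs_cos_le_one _)
    · exact Eventually.of_forall fun θ _ => hsum2
    · exact intervalIntegrable_const
    · exact Eventually.of_forall fun θ _ => hpt θ
  have hinj : Function.Injective fun k : ℕ => (n + k, k) := fun k l h => (Prod.mk.inj h).2
  have hFint : ∀ q : ℕ × ℕ, ∫ θ in (0 : ℝ)..2 * Real.pi, F q θ =
      if q.1 = n + q.2 then 2 * Real.pi * (a q.1 * a q.2) else 0 := by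
    intro q
    simp only [hF]
    rw [intervalIntegral.integral_const_mul, integral_cos_int_mul]
    have : ((q.1 : ℤ) - (q.2 : ℤ) - (n : ℤ) = 0) ↔ q.1 = n + q.2 := by omega
    simp only [this]
    split_ifs <;> ring
  simp only [hFint] at key
  -- By orthogonality only the pairs (n + k, k) contribute.
  rw [← hinj.hasSum_iff] at key
  · simpa [Function.comp_def] using key
  · rintro ⟨j, k⟩ hq
    rw [if_neg]
    intro (h : j = n + k)
    exact hq ⟨k, by rw [h]⟩

/-- The Taylor coefficients of `(1-z)^{-s}`. -/
noncomputable def negBinomCoeff (s : ℝ) (k : ℕ) : ℝ :=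
  Real.Gamma (s + k) / (Real.Gamma s * k.factorial)

lemma Gamma_add_nat_eq_ascPochhammer {s : ℝ} (hs : 0 < s) (k : ℕ) :
    Real.Gamma (s + k) = (ascPochhammer ℝ k).eval s * Real.Gamma s := by
  induction k with
  | zero => simp
  | succ k ih =>
    rw [ascPochhammer_succ_right]
    push_cast
    rw [← add_assoc, Real.Gamma_add_one (by positivity), ih]
    simp
    ring

lemma negBinomCoeff_eq_choose {s : ℝ} (hs : 0 < s) (k : ℕ) :
    negBinomCoeff s k = Ring.choose (s + k - 1) k := by
  have h := Ring.factorial_nsmul_multichoose_eq_ascPochhammer s k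
  rw [Ring.multichoose_eq, nsmul_eq_mul, Polynomial.ascPochhammer_smeval_eq_eval] at h
  rw [negBinomCoeff, Gamma_add_nat_eq_ascPochhammer hs, ← h]
  have := factorial_cast_ne_zero k
  have := (Real.Gamma_pos_of_pos hs).ne'
  field_simp

lemma negBinomCoeff_pos {s : ℝ} (hs : 0 < s) (k : ℕ) : 0 < negBinomCoeff s k := by
  have h1 : 0 < Real.Gamma (s + k) := Real.Gamma_pos_of_pos (by positivity)
  have h2 := Real.Gamma_pos_of_pos hs
  have h3 : (0 : ℝ) < k.factorial := by exact_mod_cast Nat.factorial_pos k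
  exact div_pos h1 (mul_pos h2 h3)

lemma hasSum_negBinomCoeff_complex {s : ℝ} (hs : 0 < s) {z : ℂ} (hz : ‖z‖ < 1) :
    HasSum (fun k => (negBinomCoeff s k : ℂ) * z ^ k) ((1 - z) ^ (-(s : ℂ))) := by
  have h := (Complex.one_div_one_sub_cpow_hasFPowerSeriesOnBall_zero (s : ℂ)).hasSum (y := z)
    (by rw [← ENNReal.ofReal_one, Metric.eball_ofReal]; simpa using hz)
  rw [zero_add, one_div, ← Complex.cpow_neg] at h
  have e : (fun k => (negBinomCoeff s k : ℂ) * z ^ k) = fun k =>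
      (FormalMultilinearSeries.ofScalars ℂ (fun n => Ring.choose ((s : ℂ) + n - 1) n) k)
        fun _ => z := by
    funext k
    rw [negBinomCoeff_eq_choose hs]
    simp [Complex.ofReal_choose, mul_comm]
  rw [e]
  exact h

lemma hasSum_negBinomCoeff {s x : ℝ} (hs : 0 < s) (h0 : 0 ≤ x) (h1 : x < 1) :
    HasSum (fun k => negBinomCoeff s k * x ^ k) ((1 - x) ^ (-s)) := by
  have h := hasSum_negBinomCoeff_complex hs (z := x) (by simpa [abs_of_nonneg h0] using h1)
  rw [← Complex.hasSum_ofReal]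
  rw [Complex.ofReal_cpow (by linarith)]
  push_cast
  exact h

/-- The Fourier lemma for f(z) = e^(wz), where |f(e^(iθ))|² = e^(2w cos θ). -/
lemma two_pi_mul_besselISeries (n : ℕ) (w : ℝ) :
    2 * Real.pi * besselISeries n w =
      ∫ θ in (0 : ℝ)..2 * Real.pi, Real.exp (2 * w * Real.cos θ) * Real.cos (n * θ) := by
  have h := hasSum_integral_norm_sq_mul_cos (hasSum_pow_div_factorial w).summable
    (f := fun z => Complex.exp (w * z)) (fun z _ => by
      have := NormedSpace.expSeries_div_hasSum_exp ((w : ℂ) * z)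
      rw [← Complex.exp_eq_exp_ℂ] at this
      refine this.congr_fun fun k => ?_
      push_cast
      rw [mul_pow]; ring) n
  have e : ∀ θ : ℝ, ‖Complex.exp (w * Complex.exp (θ * Complex.I))‖ ^ 2 =
      Real.exp (2 * w * Real.cos θ) := by
    intro θ
    rw [Complex.norm_exp, Complex.re_ofReal_mul, Complex.exp_ofReal_mul_I_re, ← Real.exp_nat_mul]
    congr 1; push_cast; ring
  simp only [e] at h
  rw [← h.tsum_eq, tsum_mul_left, besselISeries]
  congr 1
  refine tsum_congr fun k => ?_
  rw [div_mul_div_comm, ← pow_add, mul_comm (k.factorial : ℝ)]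
  congr 2; ring

/-- The Fourier lemma for f(z) = (1 - bz)^(-s), since |1 - b e^(iθ)|² = 1 + b² - 2b cos θ. -/
lemma hasSum_negBinomCoeff_mul {s b : ℝ} (hs : 0 < s) (hb0 : 0 < b) (hb1 : b < 1) (n : ℕ) :
    HasSum (fun k => 2 * Real.pi * (negBinomCoeff s (n + k) * negBinomCoeff s k * b ^ (n + 2 * k)))
      (∫ θ in (0 : ℝ)..2 * Real.pi,
        (1 + b ^ 2 - 2 * b * Real.cos θ) ^ (-s) * Real.cos (n * θ)) := by
  have h := hasSum_integral_norm_sq_mul_cos (hasSum_negBinomCoeff hs hb0.le hb1).summable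
    (f := fun z => (1 - b * z) ^ (-(s : ℂ))) (fun z hz => by
      have := hasSum_negBinomCoeff_complex hs (z := b * z)
        (by rw [norm_mul, hz, mul_one, Complex.norm_real, Real.norm_of_nonneg hb0.le]; exact hb1)
      refine this.congr_fun fun k => ?_
      push_cast
      rw [mul_pow]; ring) n
  have e : ∀ θ : ℝ, ‖(1 - b * Complex.exp (θ * Complex.I)) ^ (-(s : ℂ))‖ ^ 2 =
      (1 + b ^ 2 - 2 * b * Real.cos θ) ^ (-s) := by
    intro θ
    have hD : ‖1 - b * Complex.exp (θ * Complex.I)‖ ^ 2 = 1 + b ^ 2 - 2 * b * Real.cos θ := by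
      rw [← Complex.normSq_eq_norm_sq, Complex.normSq_apply]
      simp only [Complex.sub_re, Complex.one_re, Complex.re_ofReal_mul,
        Complex.exp_ofReal_mul_I_re, Complex.sub_im, Complex.one_im, Complex.im_ofReal_mul,
        Complex.exp_ofReal_mul_I_im]
      nlinarith [Real.sin_sq_add_cos_sq θ]
    rw [← hD, ← Complex.ofReal_neg, Complex.norm_cpow_real, ← Real.rpow_natCast,
      ← Real.rpow_natCast, ← Real.rpow_mul (norm_nonneg _), ← Real.rpow_mul (norm_nonneg _),
      mul_comm (-s)]
  simp only [e] at h
  refine h.congr_fun fun k => ?_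
  ring

/-- With I_n written as a Fourier integral, the u-integral is Γ(s) (1 + b² - 2b cos θ)^(-s). Fubini
needs b < 1: the base is then at least (1-b)² > 0, which gives an exponential majorant. -/
lemma integral_rpow_mul_besselISeries {s b : ℝ} (hs : 0 < s) (hb0 : 0 < b) (hb1 : b < 1) (n : ℕ) :
    HasSum (fun k => Real.Gamma s * (negBinomCoeff s (n + k) * negBinomCoeff s k * b ^ (n + 2 * k)))
      (∫ u in Ioi (0 : ℝ), u ^ (s - 1) * (Real.exp (-u) * Real.exp (-(b ^ 2 * u))) *
        besselISeries n (b * u)) := by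
  set D : ℝ → ℝ := fun θ => 1 + b ^ 2 - 2 * b * Real.cos θ with hDdef
  have hD : ∀ θ, (1 - b) ^ 2 ≤ D θ := fun θ => by
    simp only [hDdef]; nlinarith [Real.cos_le_one θ]
  have hb2 : 0 < (1 - b) ^ 2 := by have : 0 < 1 - b := by linarith
                                   positivity
  have hD0 : ∀ θ, 0 < D θ := fun θ => hb2.trans_le (hD θ)
  have hDc : Continuous D := by fun_prop
  set K : ℝ → ℝ → ℝ := fun u θ => u ^ (s - 1) * Real.exp (-(D θ * u)) * Real.cos (n * θ) with hK
  have hmaj : IntegrableOn (fun u : ℝ => u ^ (s - 1) * Real.exp (-((1 - b) ^ 2 * u))) (Ioi 0) := by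
    refine not_imp_comm.1 integral_undef ?_
    rw [Real.integral_rpow_mul_exp_neg_mul_Ioi hs hb2]
    have := Real.Gamma_pos_of_pos hs
    positivity
  have hint : Integrable (Function.uncurry K) ((volume.restrict (Ioi (0 : ℝ))).prod
      (volume.restrict (Ioc (0 : ℝ) (2 * Real.pi)))) := by
    have h1 : Integrable (fun q : ℝ × ℝ => q.1 ^ (s - 1) * Real.exp (-((1 - b) ^ 2 * q.1)) * 1)
        ((volume.restrict (Ioi (0 : ℝ))).prod (volume.restrict (Ioc (0 : ℝ) (2 * Real.pi)))) :=
      Integrable.mul_prod (f := fun u : ℝ => u ^ (s - 1) * Real.exp (-((1 - b) ^ 2 * u)))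
        (g := fun _ => (1 : ℝ)) hmaj (integrable_const 1)
    refine h1.mono' ?_ ?_
    · rw [Measure.prod_restrict]
      refine ContinuousOn.aestronglyMeasurable ?_ (measurableSet_Ioi.prod measurableSet_Ioc)
      refine ContinuousOn.mul (ContinuousOn.mul ?_ ?_) ?_
      · exact continuous_fst.continuousOn.rpow_const fun q hq => Or.inl (ne_of_gt hq.1)
      · exact (by fun_prop : Continuous fun q : ℝ × ℝ => Real.exp (-(D q.2 * q.1))).continuousOn
      · exact (by fun_prop : Continuous fun q : ℝ × ℝ => Real.cos (n * q.2)).continuousOn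
    · rw [Measure.prod_restrict]
      filter_upwards [ae_restrict_mem (measurableSet_Ioi.prod measurableSet_Ioc)] with q hq
      have hq0 : (0 : ℝ) < q.1 := hq.1
      have h3 : Real.exp (-(D q.2 * q.1)) ≤ Real.exp (-((1 - b) ^ 2 * q.1)) := by
        refine Real.exp_le_exp.2 (neg_le_neg ?_)
        exact mul_le_mul_of_nonneg_right (hD _) hq0.le
      simp only [Function.uncurry, hK]
      rw [norm_mul, Real.norm_of_nonneg (by positivity), Real.norm_eq_abs]
      have h4 := Real.abs_cos_le_one (n * q.2)
      gcongr
  have hswap := integral_integral_swap hint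
  have hleft : ∫ u in Ioi (0 : ℝ), ∫ θ in Ioc (0 : ℝ) (2 * Real.pi), K u θ =
      2 * Real.pi * ∫ u in Ioi (0 : ℝ), u ^ (s - 1) * (Real.exp (-u) * Real.exp (-(b ^ 2 * u))) *
        besselISeries n (b * u) := by
    rw [← integral_const_mul]
    refine setIntegral_congr_fun measurableSet_Ioi fun u _ => ?_
    rw [mul_left_comm, two_pi_mul_besselISeries,
      intervalIntegral.integral_of_le Real.two_pi_pos.le, ← integral_const_mul]
    refine integral_congr_ae (Eventually.of_forall fun θ => ?_)
    simp only [hK, hDdef]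
    have hE : Real.exp (-((1 + b ^ 2 - 2 * b * Real.cos θ) * u)) =
        Real.exp (-u) * Real.exp (-(b ^ 2 * u)) * Real.exp (2 * (b * u) * Real.cos θ) := by
      rw [← Real.exp_add, ← Real.exp_add]; congr 1; ring
    rw [hE]; ring
  have hright : ∫ θ in Ioc (0 : ℝ) (2 * Real.pi), ∫ u in Ioi (0 : ℝ), K u θ =
      Real.Gamma s * ∫ θ in (0 : ℝ)..2 * Real.pi, D θ ^ (-s) * Real.cos (n * θ) := by
    rw [intervalIntegral.integral_of_le Real.two_pi_pos.le, ← integral_const_mul]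
    refine integral_congr_ae (Eventually.of_forall fun θ => ?_)
    simp only [hK]
    rw [integral_mul_const, Real.integral_rpow_mul_exp_neg_mul_Ioi hs (hD0 θ), one_div,
      Real.inv_rpow (hD0 θ).le, ← Real.rpow_neg (hD0 θ).le]
    ring
  rw [hleft, hright] at hswap
  have hfin := (hasSum_negBinomCoeff_mul hs hb0 hb1 n).mul_left (Real.Gamma s / (2 * Real.pi))
  have hpi := Real.two_pi_pos.ne'
  have e : ∫ u in Ioi (0 : ℝ), u ^ (s - 1) * (Real.exp (-u) * Real.exp (-(b ^ 2 * u))) *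
      besselISeries n (b * u) = Real.Gamma s / (2 * Real.pi) *
      ∫ θ in (0 : ℝ)..2 * Real.pi, D θ ^ (-s) * Real.cos (n * θ) := by
    rw [div_mul_eq_mul_div, ← hswap, mul_div_cancel_left₀ _ hpi]
  rw [e]
  refine hfin.congr_fun fun k => ?_
  field_simp

/-! ### Euler's integral for Λ_n(b), and the closed form at b = 1. -/

lemma integral_rpow_mul_one_sub_rpow {p q : ℝ} (hp : 0 < p) (hq : 0 < q) :
    ∫ x in Ioo (0 : ℝ) 1, x ^ (p - 1) * (1 - x) ^ (q - 1) =
      Real.Gamma p * Real.Gamma q / Real.Gamma (p + q) := by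
  have h := Complex.betaIntegral_eq_Gamma_mul_div (p : ℂ) (q : ℂ) (by simpa) (by simpa)
  rw [Complex.betaIntegral, intervalIntegral.integral_of_le zero_le_one,
    integral_Ioc_eq_integral_Ioo] at h
  have e : ∫ x in Ioo (0 : ℝ) 1, (x : ℂ) ^ ((p : ℂ) - 1) * (1 - (x : ℂ)) ^ ((q : ℂ) - 1) =
      ∫ x in Ioo (0 : ℝ) 1, ((x ^ (p - 1) * (1 - x) ^ (q - 1) : ℝ) : ℂ) := by
    refine setIntegral_congr_fun measurableSet_Ioo fun x hx => ?_
    rw [Complex.ofReal_mul, Complex.ofReal_cpow hx.1.le, Complex.ofReal_cpow (by linarith [hx.2])]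
    push_cast
    rfl
  rw [e, integral_complex_ofReal, Complex.Gamma_ofReal, Complex.Gamma_ofReal, ← Complex.ofReal_add,
    Complex.Gamma_ofReal] at h
  exact_mod_cast h

lemma integrableOn_rpow_mul_one_sub_rpow {p q : ℝ} (hp : 0 < p) (hq : 0 < q) :
    IntegrableOn (fun x : ℝ => x ^ (p - 1) * (1 - x) ^ (q - 1)) (Ioo 0 1) := by
  refine not_imp_comm.1 integral_undef ?_
  rw [integral_rpow_mul_one_sub_rpow hp hq]
  have := Real.Gamma_pos_of_pos hp
  have := Real.Gamma_pos_of_pos hq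
  have := Real.Gamma_pos_of_pos (add_pos hp hq)
  positivity

/-- The integrand of Euler's integral for the hypergeometric function `F(n+s, s; n+1; b²)`. -/
noncomputable def eulerIntegrand (s : ℝ) (n : ℕ) (b x : ℝ) : ℝ :=
  x ^ (n + s - 1) * (1 - x) ^ (-s) * (1 - b ^ 2 * x) ^ (-s)

/-- Euler's integral for the hypergeometric function `F(n+s, s; n+1; b²)`. -/
noncomputable def eulerIntegral (s : ℝ) (n : ℕ) (b : ℝ) : ℝ :=
  ∫ x in Ioo (0 : ℝ) 1, eulerIntegrand s n b x

/-- Γ(n+k+s)/(n+k)! is, up to the factor Γ(1-s), the Beta integral with parameters n+k+s and 1-s.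
The remaining series in b²x sums to (1 - b²x)^(-s), and positivity of the terms justifies the
exchange. -/
lemma integral_rpow_mul_besselISeries_eq_eulerIntegral {s b : ℝ} (hs0 : 0 < s) (hs1 : s < 1)
    (hb0 : 0 < b) (hb1 : b < 1) (n : ℕ) :
    ∫ u in Ioi (0 : ℝ), u ^ (s - 1) * (Real.exp (-u) * Real.exp (-(b ^ 2 * u))) *
      besselISeries n (b * u) = b ^ n / Real.Gamma (1 - s) * eulerIntegral s n b := by
  have hG : 0 < Real.Gamma (1 - s) := Real.Gamma_pos_of_pos (by linarith)
  have hGs : 0 < Real.Gamma s := Real.Gamma_pos_of_pos hs0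
  have h := integral_rpow_mul_besselISeries hs0 hb0 hb1 n
  have hpos : ∀ k : ℕ, (0 : ℝ) < n + k + s := fun k => by positivity
  set F : ℕ → ℝ → ℝ := fun k x => negBinomCoeff s k * b ^ (2 * k) *
    (x ^ (n + k + s - 1) * (1 - x) ^ (1 - s - 1)) with hF
  have hFint : ∀ k, ∫ x in Ioo (0 : ℝ) 1, F k x = Real.Gamma (1 - s) / b ^ n *
      (Real.Gamma s * (negBinomCoeff s (n + k) * negBinomCoeff s k * b ^ (n + 2 * k))) := by
    intro k
    simp only [hF]
    rw [integral_const_mul, integral_rpow_mul_one_sub_rpow (hpos k) (by linarith),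
      show (n : ℝ) + k + s + (1 - s) = ((n + k : ℕ) : ℝ) + 1 by push_cast; ring,
      Real.Gamma_nat_eq_factorial, negBinomCoeff, negBinomCoeff]
    have := factorial_cast_ne_zero (n + k)
    have := factorial_cast_ne_zero k
    push_cast
    rw [show s + ((n : ℝ) + k) = n + k + s by ring, pow_add b n]
    field_simp
  have hnorm : ∀ k, ∫ x in Ioo (0 : ℝ) 1, ‖F k x‖ = ∫ x in Ioo (0 : ℝ) 1, F k x := by
    intro k
    refine setIntegral_congr_fun measurableSet_Ioo fun x hx => ?_
    have h1 : 0 < 1 - x := by linarith [hx.2]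
    have h0 := hx.1
    have := negBinomCoeff_pos hs0 k
    exact Real.norm_of_nonneg (by simp only [hF]; positivity)
  have key := hasSum_integral_of_summable_integral_norm (μ := volume.restrict (Ioo (0 : ℝ) 1))
    (F := F) (fun k => (integrableOn_rpow_mul_one_sub_rpow (hpos k) (by linarith)).const_mul _)
    (by simp only [hnorm, hFint]; exact h.summable.mul_left _)
  simp only [hFint] at key
  have e : ∫ x in Ioo (0 : ℝ) 1, ∑' k, F k x = eulerIntegral s n b := by
    refine setIntegral_congr_fun measurableSet_Ioo fun x hx => ?_
    have hb2 : b ^ 2 < 1 := by nlinarith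
    have h1 := hasSum_negBinomCoeff hs0 (x := b ^ 2 * x) (by have := hx.1; positivity)
      (by nlinarith [hx.1, hx.2])
    rw [eulerIntegrand, ← (h1.mul_left (x ^ (n + s - 1) * (1 - x) ^ (-s))).tsum_eq]
    refine tsum_congr fun k => ?_
    simp only [hF]
    rw [show (n : ℝ) + k + s - 1 = n + s - 1 + k by ring, Real.rpow_add_natCast hx.1.ne',
      show 1 - s - 1 = -s by ring, mul_pow, pow_mul]
    ring
  rw [e] at key
  have := key.unique (h.mul_left (Real.Gamma (1 - s) / b ^ n))
  have hcancel : b ^ n / Real.Gamma (1 - s) * (Real.Gamma (1 - s) / b ^ n) = 1 := by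
    field_simp
  rw [this, ← mul_assoc, hcancel, one_mul]

lemma one_sub_mul_pos {b x : ℝ} (hb0 : 0 < b) (hb1 : b ≤ 1) (hx : x ∈ Ioo (0 : ℝ) 1) :
    0 < 1 - b ^ 2 * x := by
  have : b ^ 2 ≤ 1 := by nlinarith
  nlinarith [hx.1, hx.2]

lemma eulerIntegrand_pos (s : ℝ) (n : ℕ) {b x : ℝ} (hb0 : 0 < b) (hb1 : b ≤ 1)
    (hx : x ∈ Ioo (0 : ℝ) 1) : 0 < eulerIntegrand s n b x := by
  have h0 := hx.1
  have h1 : 0 < 1 - x := by linarith [hx.2]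
  have h2 := one_sub_mul_pos hb0 hb1 hx
  rw [eulerIntegrand]
  positivity

/-- Makes the integrand at b = 1, a Beta density integrable for s < 1/2, a majorant for all b. -/
lemma eulerIntegrand_le {s : ℝ} (hs : 0 ≤ s) (n : ℕ) {b b' x : ℝ} (hb0 : 0 < b) (hbb : b ≤ b')
    (hb1 : b' ≤ 1) (hx : x ∈ Ioo (0 : ℝ) 1) :
    eulerIntegrand s n b x ≤ eulerIntegrand s n b' x := by
  have h0 := hx.1
  have h1 : 0 < 1 - x := by linarith [hx.2]
  rw [eulerIntegrand, eulerIntegrand]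
  refine mul_le_mul_of_nonneg_left ?_ (by positivity)
  refine Real.rpow_le_rpow_of_nonpos (one_sub_mul_pos (hb0.trans_le hbb) hb1 hx) ?_ (by linarith)
  have : b ^ 2 ≤ b' ^ 2 := by gcongr
  nlinarith

lemma eulerIntegrand_one (s : ℝ) (n : ℕ) {x : ℝ} (hx : x ∈ Ioo (0 : ℝ) 1) :
    eulerIntegrand s n 1 x = x ^ (n + s - 1) * (1 - x) ^ (1 - 2 * s - 1) := by
  have h1 : 0 < 1 - x := by linarith [hx.2]
  rw [eulerIntegrand, one_pow, one_mul, mul_assoc, ← Real.rpow_add h1]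
  congr 2; ring

lemma aestronglyMeasurable_eulerIntegrand (s : ℝ) (n : ℕ) {b : ℝ} (hb0 : 0 < b) (hb1 : b ≤ 1) :
    AEStronglyMeasurable (eulerIntegrand s n b) (volume.restrict (Ioo 0 1)) := by
  refine ContinuousOn.aestronglyMeasurable ?_ measurableSet_Ioo
  refine ContinuousOn.mul (ContinuousOn.mul ?_ ?_) ?_
  · exact continuousOn_id.rpow_const fun x hx => Or.inl (ne_of_gt hx.1)
  · exact ContinuousOn.rpow_const (by fun_prop) fun x hx => Or.inl (sub_pos.2 hx.2).ne'
  · exact ContinuousOn.rpow_const (by fun_prop) fun x hx =>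
      Or.inl (one_sub_mul_pos hb0 hb1 hx).ne'

lemma integrableOn_eulerIntegrand {s b : ℝ} (hs0 : 0 ≤ s) (hs1 : s < 1 / 2) {n : ℕ} (hn : 1 ≤ n)
    (hb0 : 0 < b) (hb1 : b ≤ 1) : IntegrableOn (eulerIntegrand s n b) (Ioo 0 1) := by
  have hn' : (1 : ℝ) ≤ n := by exact_mod_cast hn
  have h1 : IntegrableOn (eulerIntegrand s n 1) (Ioo 0 1) :=
    (integrableOn_rpow_mul_one_sub_rpow (p := n + s) (q := 1 - 2 * s) (by linarith)
      (by linarith)).congr_fun (fun x hx => (eulerIntegrand_one s n hx).symm) measurableSet_Ioo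
  refine h1.mono' (aestronglyMeasurable_eulerIntegrand s n hb0 hb1) ?_
  filter_upwards [ae_restrict_mem measurableSet_Ioo] with x hx
  rw [Real.norm_of_nonneg (eulerIntegrand_pos s n hb0 hb1 hx).le]
  exact eulerIntegrand_le hs0 n hb0 hb1 le_rfl hx

lemma eulerIntegral_one {s : ℝ} (hs0 : 0 ≤ s) (hs1 : s < 1 / 2) {n : ℕ} (hn : 1 ≤ n) :
    eulerIntegral s n 1 =
      Real.Gamma (n + s) * Real.Gamma (1 - 2 * s) / Real.Gamma (n + 1 - s) := by
  have hn' : (1 : ℝ) ≤ n := by exact_mod_cast hn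
  rw [eulerIntegral, setIntegral_congr_fun measurableSet_Ioo fun x hx => eulerIntegrand_one s n hx,
    integral_rpow_mul_one_sub_rpow (by linarith) (by linarith)]
  congr 2; ring

lemma tendsto_eulerIntegral_one {s : ℝ} (hs0 : 0 ≤ s) (hs1 : s < 1 / 2) {n : ℕ} (hn : 1 ≤ n) :
    Tendsto (eulerIntegral s n) (𝓝[<] 1) (𝓝 (eulerIntegral s n 1)) := by
  have hev : ∀ᶠ b : ℝ in 𝓝[<] 1, 0 < b ∧ b < 1 :=
    (Ioo_mem_nhdsLT one_pos : Ioo (0 : ℝ) 1 ∈ 𝓝[<] 1)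
  refine tendsto_integral_filter_of_dominated_convergence (eulerIntegrand s n 1) ?_ ?_
    (integrableOn_eulerIntegrand hs0 hs1 hn one_pos le_rfl) ?_
  · filter_upwards [hev] with b hb
    exact aestronglyMeasurable_eulerIntegrand s n hb.1 hb.2.le
  · filter_upwards [hev] with b hb
    filter_upwards [ae_restrict_mem measurableSet_Ioo] with x hx
    rw [Real.norm_of_nonneg (eulerIntegrand_pos s n hb.1 hb.2.le hx).le]
    exact eulerIntegrand_le hs0 n hb.1 hb.2.le le_rfl hx
  · filter_upwards [ae_restrict_mem measurableSet_Ioo] with x hx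
    have : ContinuousAt (fun b => eulerIntegrand s n b x) 1 := by
      refine continuousAt_const.mul (ContinuousAt.rpow_const (by fun_prop) (Or.inl ?_))
      exact (one_sub_mul_pos one_pos le_rfl hx).ne'
    exact this.tendsto.mono_left nhdsWithin_le_nhds

lemma integral_lambdaIntegrand_eq_eulerIntegral {s b : ℝ} (hs0 : 0 < s) (hs1 : s < 1 / 2) {n : ℕ}
    (hn : 1 ≤ n) (hb0 : 0 < b) (hb1 : b ≤ 1) :
    ∫ t in Ioi (0 : ℝ), lambdaIntegrand (2 * s) n b t =
      2 ^ (2 * s - 1) / Real.Gamma (1 - s) ^ 2 * (b ^ n * eulerIntegral s n b) := by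
  have hlt : ∀ b : ℝ, 0 < b → b < 1 → ∫ t in Ioi (0 : ℝ), lambdaIntegrand (2 * s) n b t =
      2 ^ (2 * s - 1) / Real.Gamma (1 - s) ^ 2 * (b ^ n * eulerIntegral s n b) := by
    intro b hb0 hb1
    rw [integral_lambdaIntegrand_eq_besselISeries hs0 hs1 n hb0,
      integral_rpow_mul_besselISeries_eq_eulerIntegral hs0 (by linarith) hb0 hb1]
    ring
  rcases hb1.lt_or_eq with h | rfl
  · exact hlt b hb0 h
  -- The binomial expansion needed b < 1; at b = 1 both sides are left limits.
  · have h1 := tendsto_integral_lambdaIntegrand (α := 2 * s) (by linarith) (by linarith) n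
    have h2 : Tendsto (fun b : ℝ => 2 ^ (2 * s - 1) / Real.Gamma (1 - s) ^ 2 *
        (b ^ n * eulerIntegral s n b)) (𝓝[<] 1) (𝓝 (2 ^ (2 * s - 1) / Real.Gamma (1 - s) ^ 2 *
        (1 ^ n * eulerIntegral s n 1))) :=
      Tendsto.const_mul _ ((((continuous_pow n).tendsto (1 : ℝ)).mono_left
        nhdsWithin_le_nhds).mul (tendsto_eulerIntegral_one hs0.le hs1 hn))
    refine tendsto_nhds_unique (h1.congr' ?_) h2
    filter_upwards [(Ioo_mem_nhdsLT one_pos : Ioo (0 : ℝ) 1 ∈ 𝓝[<] 1)] with b hb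
    exact hlt b hb.1 hb.2

/-- `Λ_n(b)` through Euler's integral. -/
lemma Lam_eq_eulerIntegral {s b : ℝ} (hs0 : 0 < s) (hs1 : s < 1 / 2) {n : ℕ} (hn : 1 ≤ n)
    (hb0 : 0 < b) (hb1 : b ≤ 1) :
    Lam (2 * s) n b =
      2 ^ (2 * s - 1) / Real.Gamma (1 - s) ^ 2 * (b ^ (n - 1) * eulerIntegral s n b) := by
  rw [Lam, integral_lambdaIntegrand_eq_eulerIntegral hs0 hs1 hn hb0 hb1]
  obtain ⟨m, rfl⟩ := Nat.exists_eq_add_of_le' hn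
  rw [pow_succ, Nat.add_sub_cancel]
  field_simp
  ring

/-- The closed form of `Λ_n(1)`. -/
lemma Lam_one_eq {s : ℝ} (hs0 : 0 < s) (hs1 : s < 1 / 2) {n : ℕ} (hn : 1 ≤ n) :
    Lam (2 * s) n 1 = 2 ^ (2 * s - 1) * Real.Gamma (1 - 2 * s) / Real.Gamma (1 - s) ^ 2 *
      (Real.Gamma (n + s) / Real.Gamma (n + 1 - s)) := by
  rw [Lam_eq_eulerIntegral hs0 hs1 hn one_pos le_rfl, eulerIntegral_one hs0.le hs1 hn, one_pow]
  ring

/-! ### Quotients of Gamma functions at large argument. -/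

/-- Wendel's inequality, upper bound. -/
lemma Gamma_add_le {x a : ℝ} (hx : 0 < x) (ha0 : 0 < a) (ha1 : a < 1) :
    Real.Gamma (x + a) ≤ x ^ a * Real.Gamma x := by
  have hG := Real.Gamma_pos_of_pos hx
  have h := Real.Gamma_mul_add_mul_le_rpow_Gamma_mul_rpow_Gamma (s := x) (t := x + 1) (a := 1 - a)
    (b := a) hx (by linarith) (by linarith) ha0 (by ring)
  rw [show (1 - a) * x + a * (x + 1) = x + a by ring, Real.Gamma_add_one hx.ne',
    Real.mul_rpow hx.le hG.le, mul_left_comm, ← Real.rpow_add hG, sub_add_cancel,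
    Real.rpow_one] at h
  exact h

/-- Wendel's inequality, a weak form of the lower bound. -/
lemma le_Gamma_add {x a : ℝ} (hx : 0 < x) (ha0 : 0 < a) (ha1 : a < 1) :
    x ^ a * Real.Gamma x * (x / (x + a)) ≤ Real.Gamma (x + a) := by
  -- The upper bound started at x + a with exponent 1 - a lands on Γ(x + 1) = x Γ(x).
  have h := Gamma_add_le (x := x + a) (a := 1 - a) (by linarith) (by linarith) (by linarith)
  rw [show x + a + (1 - a) = x + 1 by ring, Real.Gamma_add_one hx.ne'] at h
  have hG := Real.Gamma_pos_of_pos hx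
  have hGa := Real.Gamma_pos_of_pos (add_pos hx ha0)
  have h1 : (x + a) ^ (1 - a) * x ^ a ≤ x + a := by
    calc (x + a) ^ (1 - a) * x ^ a ≤ (x + a) ^ (1 - a) * (x + a) ^ a := by gcongr; linarith
      _ = x + a := by rw [← Real.rpow_add (by linarith), sub_add_cancel, Real.rpow_one]
  rw [mul_div_assoc', div_le_iff₀ (by linarith)]
  calc x ^ a * Real.Gamma x * x = x ^ a * (x * Real.Gamma x) := by ring
    _ ≤ x ^ a * ((x + a) ^ (1 - a) * Real.Gamma (x + a)) := by gcongr
    _ = (x + a) ^ (1 - a) * x ^ a * Real.Gamma (x + a) := by ring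
    _ ≤ (x + a) * Real.Gamma (x + a) := by gcongr
    _ = _ := by ring

/-- Wendel's bounds with exponent s in the numerator and 1 - s in the denominator; the correction
factors x/(x+a) cost a relative error of at most 1/x. -/
lemma abs_Gamma_div_sub_rpow_le {x s : ℝ} (hx : 0 < x) (hs0 : 0 < s) (hs1 : s < 1) :
    |Real.Gamma (x + s) / Real.Gamma (x + 1 - s) - x ^ (2 * s - 1)| ≤ x ^ (2 * s - 2) := by
  have hG := Real.Gamma_pos_of_pos hx
  have u1 := Gamma_add_le hx hs0 hs1
  have l1 := le_Gamma_add hx hs0 hs1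
  have u2 := Gamma_add_le (a := 1 - s) hx (by linarith) (by linarith)
  have l2 := le_Gamma_add (a := 1 - s) hx (by linarith) (by linarith)
  rw [← add_sub_assoc] at u2 l2
  have hGd : 0 < Real.Gamma (x + 1 - s) := Real.Gamma_pos_of_pos (by linarith)
  have hP1 : x ^ s = x ^ (2 * s - 1) * x ^ (1 - s) := by
    rw [← Real.rpow_add hx]; congr 1; ring
  have hP2 : x ^ (2 * s - 1) = x ^ (2 * s - 2) * x := by
    rw [← Real.rpow_add_one hx.ne']; congr 1; ring
  set P := x ^ (2 * s - 2)
  set Q := x ^ (1 - s)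
  have hP : 0 < P := by positivity
  have hQ : 0 < Q := by positivity
  rw [hP1, hP2] at u1 l1
  rw [hP2, abs_le]
  constructor
  · rw [neg_le_sub_iff_le_add, ← sub_le_iff_le_add, le_div_iff₀ hGd]
    refine le_trans ?_ l1
    rcases le_total (P * x - P) 0 with h | h
    · exact (mul_nonpos_of_nonpos_of_nonneg h hGd.le).trans (by positivity)
    · refine (mul_le_mul_of_nonneg_left u2 h).trans ?_
      have h3 : x - 1 ≤ x * (x / (x + s)) := by
        rw [mul_div_assoc', le_div_iff₀ (by linarith)]; nlinarith
      calc (P * x - P) * (Q * Real.Gamma x) = P * Q * Real.Gamma x * (x - 1) := by ring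
        _ ≤ P * Q * Real.Gamma x * (x * (x / (x + s))) := by gcongr
        _ = _ := by ring
  · rw [sub_le_iff_le_add, div_le_iff₀ hGd]
    refine u1.trans ?_
    have h3 : x ≤ (x + 1) * (x / (x + 1 - s)) := by
      rw [mul_div_assoc', le_div_iff₀ (by linarith)]; nlinarith
    calc P * x * Q * Real.Gamma x = P * Q * Real.Gamma x * x := by ring
      _ ≤ P * Q * Real.Gamma x * ((x + 1) * (x / (x + 1 - s))) := by gcongr
      _ = (P + P * x) * (Q * Real.Gamma x * (x / (x + 1 - s))) := by ring
      _ ≤ _ := by gcongr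

/-! ### The constant e^(αγ + c_α) as a quotient of Gamma functions. -/

/-- The terms of the double series for `log Γ(1-z) - log Γ(1+z) - 2γz`. -/
noncomputable def logGammaTerm (z : ℝ) (q : ℕ × ℕ) : ℝ :=
  2 / (2 * q.2 + 3) * (z / (q.1 + 1)) ^ (2 * q.2 + 3)

lemma summable_logGammaTerm {z : ℝ} (h0 : 0 < z) (h1 : z < 1) : Summable (logGammaTerm z) := by
  have hg : Summable fun m : ℕ => 2 * z ^ 3 * (z ^ 2) ^ m :=
    (summable_geometric_of_lt_one (by positivity) (by nlinarith)).mul_left _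
  have hz : Summable fun j : ℕ => 1 / ((j : ℝ) + 1) ^ 2 := by
    simpa using (summable_nat_add_iff 1).2 (Real.summable_one_div_nat_pow.2 (one_lt_two))
  refine Summable.of_nonneg_of_le (fun q => ?_) (fun q => ?_)
    (hz.mul_of_nonneg hg (fun j => by positivity) (fun m => by positivity))
  · rw [logGammaTerm]; positivity
  · rw [logGammaTerm, div_pow]
    have hj : (1 : ℝ) ≤ (q.1 : ℝ) + 1 := by linarith [(Nat.cast_nonneg q.1 : (0 : ℝ) ≤ q.1)]
    have e1 : 2 / (2 * (q.2 : ℝ) + 3) ≤ 2 := div_le_self two_pos.le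
      (by linarith [(Nat.cast_nonneg q.2 : (0 : ℝ) ≤ q.2)])
    have e2 : ((q.1 : ℝ) + 1) ^ 2 ≤ ((q.1 : ℝ) + 1) ^ (2 * q.2 + 3) :=
      pow_le_pow_right₀ hj (by omega)
    calc 2 / (2 * (q.2 : ℝ) + 3) * (z ^ (2 * q.2 + 3) / ((q.1 : ℝ) + 1) ^ (2 * q.2 + 3))
        ≤ 2 * (z ^ (2 * q.2 + 3) / ((q.1 : ℝ) + 1) ^ 2) := by gcongr
      _ = _ := by rw [pow_add, pow_mul]; ring

/-- The series of log(1+w) - log(1-w) at w = z/(j+1) without its linear term, whose sum over j would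
diverge. -/
lemma hasSum_logGammaTerm_snd {z : ℝ} (h0 : 0 < z) (h1 : z < 1) (j : ℕ) :
    HasSum (fun m => logGammaTerm z (j, m))
      (Real.log (1 + z / (j + 1)) - Real.log (1 - z / (j + 1)) - 2 * z * (1 / (j + 1))) := by
  have hj : (1 : ℝ) ≤ (j : ℝ) + 1 := by linarith [(Nat.cast_nonneg j : (0 : ℝ) ≤ j)]
  have h : |z / ((j : ℝ) + 1)| < 1 := by
    rw [abs_of_pos (by positivity)]
    exact (div_le_self h0.le hj).trans_lt h1
  have h2 := (hasSum_nat_add_iff' 1).2 (Real.hasSum_log_sub_log_of_abs_lt_one h)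
  have e : Real.log (1 + z / (j + 1)) - Real.log (1 - z / (j + 1)) - 2 * z * (1 / (j + 1)) =
      Real.log (1 + z / (j + 1)) - Real.log (1 - z / (j + 1)) -
      ∑ i ∈ Finset.range 1, (2 : ℝ) * (1 / (2 * i + 1)) * (z / (j + 1)) ^ (2 * i + 1) := by
    simp; ring
  rw [e]
  refine h2.congr_fun fun m => ?_
  rw [logGammaTerm]
  push_cast
  rw [show 2 * (m + 1) + 1 = 2 * m + 3 by ring, show 2 * ((m : ℝ) + 1) + 1 = 2 * m + 3 by ring]
  ring

lemma tsum_logGammaTerm_fst (z : ℝ) (m : ℕ) :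
    ∑' j : ℕ, logGammaTerm z (j, m) =
      (2 * z) ^ (2 * (m + 1) + 1) / (2 ^ (2 * (m + 1)) * (2 * ((m : ℝ) + 1) + 1)) *
        (riemannZeta (2 * ((m : ℂ) + 1) + 1)).re := by
  have hz : (riemannZeta (2 * ((m : ℂ) + 1) + 1)).re =
      ∑' j : ℕ, 1 / ((j : ℝ) + 1) ^ (2 * m + 3) := by
    have h := zeta_nat_eq_tsum_of_gt_one (k := 2 * m + 3) (by omega)
    have hs : Summable fun n : ℕ => 1 / (n : ℝ) ^ (2 * m + 3) :=
      Real.summable_one_div_nat_pow.2 (by omega)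
    have h' : ((2 * m + 3 : ℕ) : ℂ) = 2 * ((m : ℂ) + 1) + 1 := by push_cast; ring
    rw [h'] at h
    have h2 : ∑' n : ℕ, 1 / (n : ℂ) ^ (2 * m + 3) =
        ((∑' n : ℕ, 1 / (n : ℝ) ^ (2 * m + 3) : ℝ) : ℂ) := by
      push_cast; rfl
    rw [h, h2, Complex.ofReal_re, hs.tsum_eq_zero_add]
    simp
  rw [hz, ← tsum_mul_left]
  refine tsum_congr fun j => ?_
  rw [logGammaTerm, show 2 * (m + 1) + 1 = 2 * m + 3 by ring,
    show 2 * ((m : ℝ) + 1) + 1 = 2 * m + 3 by ring, div_pow, mul_pow,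
    show (2 : ℝ) ^ (2 * m + 3) = 2 * 2 ^ (2 * (m + 1)) by ring]
  field_simp

/-- Summing the double series over j first gives the zeta values of `cAlpha (2 * z)`; summing over
the power first gives these logarithms. -/
lemma hasSum_cAlpha {z : ℝ} (h0 : 0 < z) (h1 : z < 1) :
    HasSum (fun j : ℕ => Real.log (1 + z / (j + 1)) - Real.log (1 - z / (j + 1))
      - 2 * z * (1 / (j + 1))) (cAlpha (2 * z)) := by
  have hs := summable_logGammaTerm h0 h1
  have e1 := hs.hasSum.prod_fiberwise (hasSum_logGammaTerm_snd h0 h1)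
  have e2 : ∑' q, logGammaTerm z q = cAlpha (2 * z) := by
    have := hs.prod_symm.tsum_prod
    rw [cAlpha, ← (Equiv.prodComm ℕ ℕ).tsum_eq]
    refine this.trans (tsum_congr fun m => ?_)
    exact tsum_logGammaTerm_fst z m
  rw [← e2]
  exact e1

/-- The Taylor expansion of `log Γ(1-z) - log Γ(1+z)`, in exponential form. -/
lemma exp_cAlpha_eq {z : ℝ} (h0 : 0 < z) (h1 : z < 1) :
    Real.exp (2 * z * Real.eulerMascheroniConstant + cAlpha (2 * z)) =
      Real.Gamma (1 - z) / Real.Gamma (1 + z) := by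
  have hGz := (Real.Gamma_pos_of_pos h0).ne'
  -- In Euler's sequences for Γ(-z) and Γ(z), the sign cancels the quotient of the j = 0 factors,
  -- leaving exactly n^(-2z) ∏ (j+z)/(j-z) over 1 ≤ j ≤ n.
  have hratio : Real.Gamma (1 - z) / Real.Gamma (1 + z) = -(Real.Gamma (-z) / Real.Gamma z) := by
    rw [add_comm 1 z, sub_eq_neg_add, Real.Gamma_add_one h0.ne',
      Real.Gamma_add_one (neg_ne_zero.2 h0.ne')]
    field_simp
  have hlim1 : Tendsto (fun n => -(Real.GammaSeq (-z) n / Real.GammaSeq z n)) atTop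
      (𝓝 (Real.Gamma (1 - z) / Real.Gamma (1 + z))) := by
    rw [hratio]
    exact ((Real.GammaSeq_tendsto_Gamma (-z)).div (Real.GammaSeq_tendsto_Gamma z) hGz).neg
  have hlim2 : Tendsto (fun n : ℕ => Real.exp (2 * z * ((harmonic n : ℝ) - Real.log n) +
      ∑ j ∈ Finset.range n, (Real.log (1 + z / (j + 1)) - Real.log (1 - z / (j + 1))
      - 2 * z * (1 / (j + 1))))) atTop
      (𝓝 (Real.exp (2 * z * Real.eulerMascheroniConstant + cAlpha (2 * z)))) :=
    (Real.continuous_exp.tendsto _).comp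
      ((Real.tendsto_harmonic_sub_log.const_mul _).add (hasSum_cAlpha h0 h1).tendsto_sum_nat)
  refine tendsto_nhds_unique hlim2 (hlim1.congr' ?_)
  filter_upwards [eventually_gt_atTop 0] with n hn
  have hn0 : (0 : ℝ) < n := by exact_mod_cast hn
  -- The harmonic number cancels the linear corrections, so the two sequences agree for every n > 0.
  have hH : 2 * z * ((harmonic n : ℝ) - Real.log n) +
      ∑ j ∈ Finset.range n, (Real.log (1 + z / (j + 1)) - Real.log (1 - z / (j + 1))
      - 2 * z * (1 / (j + 1))) = Real.log n * (-(2 * z)) +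
      ∑ j ∈ Finset.range n, (Real.log (1 + z / (j + 1)) - Real.log (1 - z / (j + 1))) := by
    rw [Finset.sum_sub_distrib, ← Finset.mul_sum, harmonic]
    push_cast
    simp only [one_div]
    ring
  rw [hH, Real.exp_add, ← Real.rpow_def_of_pos hn0, Real.exp_sum]
  have hterm : ∀ j ∈ Finset.range n, Real.exp (Real.log (1 + z / ((j : ℝ) + 1)) -
      Real.log (1 - z / (j + 1))) = (z + (j + 1 : ℕ)) / (-z + (j + 1 : ℕ)) := by
    intro j _
    have hj : (1 : ℝ) ≤ (j : ℝ) + 1 := by linarith [(Nat.cast_nonneg j : (0 : ℝ) ≤ j)]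
    have h2 : z / ((j : ℝ) + 1) < 1 := (div_le_self h0.le hj).trans_lt h1
    have h3 : 0 < 1 - z / ((j : ℝ) + 1) := by linarith
    have h4 : -z + ((j : ℝ) + 1) ≠ 0 := by linarith
    rw [Real.exp_sub, Real.exp_log (by positivity), Real.exp_log h3]
    push_cast
    rw [div_eq_div_iff h3.ne' h4]
    field_simp
    ring
  rw [Finset.prod_congr rfl hterm, Finset.prod_div_distrib, Real.GammaSeq, Real.GammaSeq,
    Finset.prod_range_succ' _ n, Finset.prod_range_succ' _ n]
  have hA : ∏ j ∈ Finset.range n, (z + ((j + 1 : ℕ) : ℝ)) ≠ 0 :=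
    Finset.prod_ne_zero_iff.2 fun j _ => by positivity
  have hB : ∏ j ∈ Finset.range n, (-z + ((j + 1 : ℕ) : ℝ)) ≠ 0 :=
    Finset.prod_ne_zero_iff.2 fun j _ => by
      push_cast; linarith [(Nat.cast_nonneg j : (0 : ℝ) ≤ j)]
  have hnz : (n : ℝ) ^ z ≠ 0 := (Real.rpow_pos_of_pos hn0 z).ne'
  have hf := factorial_cast_ne_zero n
  rw [show -(2 * z) = -z - z by ring, Real.rpow_sub hn0]
  simp only [Nat.cast_zero, add_zero]
  field_simp

/-! ### Lommel's primitive and the limit α → 1 of Λ_n(b). -/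

/-- Lommel's primitive: `lommel n b / (1 - b²)` is a primitive of `t J_n(bt) J_n(t)`. -/
noncomputable def lommel (n : ℕ) (b t : ℝ) : ℝ :=
  t * (besselJ n (b * t) * besselJ (n + 1) t - b * (besselJ (n + 1) (b * t) * besselJ n t))

lemma hasDerivAt_lommel (n : ℕ) {b t : ℝ} (hb : 0 < b) (ht : 0 < t) :
    HasDerivAt (lommel n b) ((1 - b ^ 2) * (t * (besselJ n (b * t) * besselJ n t))) t := by
  have hbt : b * t ≠ 0 := (mul_pos hb ht).ne'
  have hm : HasDerivAt (fun t => b * t) b t := by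
    simpa using (hasDerivAt_id t).const_mul b
  have h1 := hasDerivAt_besselJ n ht.ne'
  have h2 := hasDerivAt_besselJ_succ n ht.ne'
  have h3 : HasDerivAt (fun t => besselJ n (b * t)) _ t := (hasDerivAt_besselJ n hbt).comp t hm
  have h4 : HasDerivAt (fun t => besselJ (n + 1) (b * t)) _ t :=
    (hasDerivAt_besselJ_succ n hbt).comp t hm
  have h := (hasDerivAt_id t).mul ((h3.mul h2).sub ((h4.mul h1).const_mul b))
  refine h.congr_deriv ?_
  simp only [id, Pi.sub_apply, Pi.mul_apply]
  field_simp
  ring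

lemma continuous_lommel (n : ℕ) (b : ℝ) : Continuous (lommel n b) := by
  have hm : Continuous fun t : ℝ => b * t := by fun_prop
  exact continuous_id.mul ((((continuous_besselJ n).comp hm).mul (continuous_besselJ (n + 1))).sub
    (continuous_const.mul (((continuous_besselJ (n + 1)).comp hm).mul (continuous_besselJ n))))

/-- Near 0 the factor of index n + 1 is O(t), which gives t²; for t > 1 the products of Bessel
functions are O(1/t), which compensates the factor t. -/
lemma exists_abs_lommel_le (n : ℕ) {b : ℝ} (hb : 0 < b) (hb1 : b ≤ 1) :
    ∃ C : ℝ, 0 < C ∧ ∀ t, 0 < t → |lommel n b t| ≤ C * gluedRpow 2 0 t := by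
  obtain ⟨C, hC0, hC⟩ := exists_abs_besselJ_le n
  obtain ⟨D, hD0, hD⟩ := exists_abs_besselJ_succ_le_mul n
  obtain ⟨A, hA0, hA⟩ := exists_abs_mul_besselJ_le n (n + 1)
  obtain ⟨B, hB0, hB⟩ := exists_abs_mul_besselJ_le (n + 1) n
  refine ⟨max (2 * (C * D)) ((A + B) / √b), lt_max_of_lt_left (by positivity), fun t ht => ?_⟩
  have htri : |lommel n b t| ≤ t * (|besselJ n (b * t) * besselJ (n + 1) t| +
      |besselJ (n + 1) (b * t) * besselJ n t|) := by
    rw [lommel, abs_mul, abs_of_pos ht]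
    refine mul_le_mul_of_nonneg_left ((abs_sub _ _).trans ?_) ht.le
    refine add_le_add_right ?_ _
    rw [abs_mul, abs_of_pos hb]
    exact mul_le_of_le_one_left (abs_nonneg _) hb1
  refine htri.trans ?_
  rw [gluedRpow]
  split_ifs with h
  · refine le_trans ?_ (mul_le_mul_of_nonneg_right (le_max_left _ _) (by positivity))
    have h1 : |besselJ n (b * t) * besselJ (n + 1) t| ≤ C * (D * t) := by
      rw [abs_mul]
      exact mul_le_mul (hC _ (by positivity)) (hD t ht.le) (abs_nonneg _) hC0.le
    have h2 : |besselJ (n + 1) (b * t) * besselJ n t| ≤ D * t * C := by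
      rw [abs_mul]
      refine mul_le_mul ((hD _ (by positivity)).trans ?_) (hC t ht.le) (abs_nonneg _)
        (by positivity)
      exact mul_le_mul_of_nonneg_left (mul_le_of_le_one_left ht.le hb1) hD0.le
    rw [Real.rpow_two]
    calc _ ≤ t * (C * (D * t) + D * t * C) := by gcongr
      _ = _ := by ring
  · refine le_trans ?_ (mul_le_mul_of_nonneg_right (le_max_right _ _) (by positivity))
    rw [Real.rpow_zero, mul_one]
    calc _ ≤ t * (A / (√b * t) + B / (√b * t)) := by
          gcongr
          · exact hA b t hb ht
          · exact hB b t hb ht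
      _ = _ := by have := Real.sqrt_pos.2 hb; field_simp

/-- The exponents are a - 1 ≥ -1/2 near 0 and a - 3 ≤ -2 at infinity, so the majorant is integrable
and uniform in a, including a = 1. -/
lemma rpow_mul_gluedRpow_le {a t : ℝ} (ha : 1 / 2 < a) (ha1 : a ≤ 1) (ht : 0 < t) :
    t ^ (a - 3) * gluedRpow 2 0 t ≤ gluedRpow (-(1 / 2)) (-2) t := by
  rw [gluedRpow, gluedRpow]
  split_ifs with h
  · rw [← Real.rpow_add ht]
    exact Real.rpow_le_rpow_of_exponent_ge ht h (by linarith)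
  · rw [← Real.rpow_add ht]
    exact Real.rpow_le_rpow_of_exponent_le (not_le.1 h).le (by linarith)

lemma exists_abs_rpow_mul_lommel_le (n : ℕ) {b : ℝ} (hb : 0 < b) (hb1 : b ≤ 1) :
    ∃ C : ℝ, 0 < C ∧ ∀ a t : ℝ, 1 / 2 < a → a ≤ 1 → 0 < t →
      |t ^ (a - 3) * lommel n b t| ≤ C * gluedRpow (-(1 / 2)) (-2) t := by
  obtain ⟨C, hC0, hC⟩ := exists_abs_lommel_le n hb hb1
  refine ⟨C, hC0, fun a t ha ha1 ht => ?_⟩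
  have hp : 0 < t ^ (a - 3) := Real.rpow_pos_of_pos ht _
  rw [abs_mul, abs_of_pos hp]
  calc t ^ (a - 3) * |lommel n b t| ≤ t ^ (a - 3) * (C * gluedRpow 2 0 t) := by
        gcongr; exact hC t ht
    _ = C * (t ^ (a - 3) * gluedRpow 2 0 t) := by ring
    _ ≤ _ := by gcongr; exact rpow_mul_gluedRpow_le ha ha1 ht

lemma aestronglyMeasurable_rpow_mul_lommel (n : ℕ) (a b : ℝ) :
    AEStronglyMeasurable (fun t => t ^ (a - 3) * lommel n b t) (volume.restrict (Ioi 0)) :=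
  ContinuousOn.aestronglyMeasurable
    ((continuousOn_id.rpow_const fun _ ht => Or.inl (ne_of_gt ht)).mul
      (continuous_lommel n b).continuousOn) measurableSet_Ioi

lemma integrableOn_rpow_mul_lommel (n : ℕ) {a b : ℝ} (hb : 0 < b) (hb1 : b ≤ 1) (ha : 1 / 2 < a)
    (ha1 : a ≤ 1) : IntegrableOn (fun t => t ^ (a - 3) * lommel n b t) (Ioi 0) := by
  obtain ⟨C, -, hC⟩ := exists_abs_rpow_mul_lommel_le n hb hb1
  refine ((integrableOn_gluedRpow (p := -(1 / 2)) (q := -2) (by norm_num)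
    (by norm_num)).const_mul C).mono' (aestronglyMeasurable_rpow_mul_lommel n a b) ?_
  filter_upwards [ae_restrict_mem measurableSet_Ioi] with t ht
  exact hC a t ha ha1 ht

lemma tendsto_integral_rpow_mul_lommel (n : ℕ) {b : ℝ} (hb : 0 < b) (hb1 : b ≤ 1) :
    Tendsto (fun a : ℝ => ∫ t in Ioi (0 : ℝ), t ^ (a - 3) * lommel n b t) (𝓝[<] 1)
      (𝓝 (∫ t in Ioi (0 : ℝ), t ^ ((1 : ℝ) - 3) * lommel n b t)) := by
  obtain ⟨C, -, hC⟩ := exists_abs_rpow_mul_lommel_le n hb hb1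
  refine tendsto_integral_filter_of_dominated_convergence
    (fun t => C * gluedRpow (-(1 / 2)) (-2) t)
    (Eventually.of_forall fun a => aestronglyMeasurable_rpow_mul_lommel n a b) ?_
    ((integrableOn_gluedRpow (by norm_num) (by norm_num)).const_mul C) ?_
  · filter_upwards [(Ioo_mem_nhdsLT (by norm_num) : Ioo (1 / 2 : ℝ) 1 ∈ 𝓝[<] 1)] with a ha
    filter_upwards [ae_restrict_mem measurableSet_Ioi] with t ht
    exact hC a t ha.1 ha.2.le ht
  · filter_upwards [ae_restrict_mem measurableSet_Ioi] with t ht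
    have ht' : (0 : ℝ) < t := ht
    have : Continuous fun a : ℝ => t ^ (a - 3) * lommel n b t :=
      (Real.continuous_const_rpow ht'.ne').comp (by fun_prop : Continuous fun a : ℝ => a - 3) |>.mul
        continuous_const
    exact (this.tendsto 1).mono_left nhdsWithin_le_nhds

/-- Boundary terms of the integration by parts against Lommel's primitive. -/
lemma tendsto_rpow_mul_lommel (n : ℕ) {a b : ℝ} (hb : 0 < b) (hb1 : b ≤ 1) (ha : 0 < a)
    (ha1 : a ≤ 1) : Tendsto (fun t => t ^ (a - 2) * lommel n b t) (𝓝[>] 0) (𝓝 0) ∧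
      Tendsto (fun t => t ^ (a - 2) * lommel n b t) atTop (𝓝 0) := by
  obtain ⟨C, hC0, hC⟩ := exists_abs_lommel_le n hb hb1
  have hle : ∀ t, 0 < t → ‖t ^ (a - 2) * lommel n b t‖ ≤ C * (t ^ (a - 2) * gluedRpow 2 0 t) := by
    intro t ht
    have hp : 0 < t ^ (a - 2) := Real.rpow_pos_of_pos ht _
    rw [norm_mul, Real.norm_of_nonneg hp.le, Real.norm_eq_abs, mul_left_comm]
    gcongr
    exact hC t ht
  constructor
  · refine squeeze_zero_norm' (a := fun t => C * t ^ a) ?_ ?_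
    · filter_upwards [(Ioo_mem_nhdsGT one_pos : Ioo (0 : ℝ) 1 ∈ 𝓝[>] 0)] with t ht
      refine (hle t ht.1).trans_eq ?_
      rw [gluedRpow, if_pos ht.2.le, ← Real.rpow_add ht.1, sub_add_cancel]
    · have : Tendsto (fun t : ℝ => C * t ^ a) (𝓝 0) (𝓝 (C * 0 ^ a)) :=
        ((Real.continuousAt_rpow_const 0 a (Or.inr ha.le)).tendsto).const_mul C
      rw [Real.zero_rpow ha.ne', mul_zero] at this
      exact this.mono_left nhdsWithin_le_nhds
  · refine squeeze_zero_norm' (a := fun t => C * t ^ (-(2 - a))) ?_ ?_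
    · filter_upwards [eventually_gt_atTop 1] with t ht
      refine (hle t (by linarith)).trans_eq ?_
      rw [gluedRpow, if_neg (not_le.2 ht), Real.rpow_zero, mul_one, neg_sub]
    · simpa using (tendsto_rpow_neg_atTop (by linarith : 0 < 2 - a)).const_mul C

/-- Integration by parts with t^(a-2) and Lommel's primitive; the resulting integral converges
absolutely up to a = 1. -/
lemma one_sub_sq_mul_integral_lambdaIntegrand (n : ℕ) {a b : ℝ} (hb : 0 < b) (hb1 : b ≤ 1)
    (ha : 1 / 2 < a) (ha1 : a < 1) :
    (1 - b ^ 2) * ∫ t in Ioi (0 : ℝ), lambdaIntegrand a n b t =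
      (2 - a) * ∫ t in Ioi (0 : ℝ), t ^ (a - 3) * lommel n b t := by
  obtain ⟨hz, hi⟩ := tendsto_rpow_mul_lommel n hb hb1 (by linarith : 0 < a) ha1.le
  have e1 : ∀ t ∈ Ioi (0 : ℝ), t ^ (a - 2) * ((1 - b ^ 2) * (t * (besselJ n (b * t) * besselJ n t)))
      = (1 - b ^ 2) * lambdaIntegrand a n b t := by
    intro t ht
    have ht' : (0 : ℝ) < t := ht
    have : t ^ (a - 2) * t = (t ^ (1 - a))⁻¹ := by
      rw [← Real.rpow_neg ht'.le, ← Real.rpow_add_one ht'.ne']; congr 1; ring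
    rw [lambdaIntegrand, div_eq_mul_inv, ← this]; ring
  have h := integral_Ioi_mul_deriv_eq_deriv_mul (a := 0) (u := fun t : ℝ => t ^ (a - 2))
    (u' := fun t => (a - 2) * t ^ (a - 3)) (v := lommel n b)
    (v' := fun t => (1 - b ^ 2) * (t * (besselJ n (b * t) * besselJ n t)))
    (fun t ht => by
      have ht' : (0 : ℝ) < t := ht
      refine (Real.hasDerivAt_rpow_const (Or.inl ht'.ne')).congr_deriv ?_
      rw [show a - 2 - 1 = a - 3 by ring])
    (fun t ht => hasDerivAt_lommel n hb ht)
    (IntegrableOn.congr_fun ((integrableOn_lambdaIntegrand (by linarith) ha1 n hb).const_mul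
      (1 - b ^ 2)) (fun t ht => (e1 t ht).symm) measurableSet_Ioi)
    (IntegrableOn.congr_fun
      ((integrableOn_rpow_mul_lommel n hb hb1 ha ha1.le).const_mul (a - 2)) (fun t _ => by simp only [Pi.mul_apply]; ring) measurableSet_Ioi) hz hi
  rw [setIntegral_congr_fun measurableSet_Ioi e1, integral_const_mul] at h
  rw [h, sub_zero, zero_sub, ← integral_neg, ← integral_const_mul]
  refine integral_congr_ae (Eventually.of_forall fun t => ?_)
  simp only
  ring

/-- The same integration by parts at a = 1 on [0, R]; the boundary term R^(-1) · `lommel n b R`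
tends to 0. -/
lemma tendsto_intervalIntegral_mul_besselJ (n : ℕ) {b : ℝ} (hb : 0 < b) (hb1 : b ≤ 1) :
    Tendsto (fun R : ℝ => (1 - b ^ 2) * ∫ t in (0 : ℝ)..R, besselJ n (b * t) * besselJ n t) atTop
      (𝓝 (∫ t in Ioi (0 : ℝ), t ^ ((1 : ℝ) - 3) * lommel n b t)) := by
  obtain ⟨hz, hi⟩ := tendsto_rpow_mul_lommel n hb hb1 one_pos le_rfl
  have hint := integrableOn_rpow_mul_lommel n hb hb1 (by norm_num : (1 / 2 : ℝ) < 1) le_rfl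
  have hJc : Continuous fun t => besselJ n (b * t) * besselJ n t :=
    ((continuous_besselJ n).comp (by fun_prop)).mul (continuous_besselJ n)
  have hlim := hi.add (intervalIntegral_tendsto_integral_Ioi 0 hint tendsto_id)
  rw [zero_add] at hlim
  refine hlim.congr' ?_
  filter_upwards [eventually_gt_atTop 0] with R hR
  have hintR : IntervalIntegrable (fun t => t ^ ((1 : ℝ) - 3) * lommel n b t) volume 0 R :=
    (intervalIntegrable_iff_integrableOn_Ioc_of_le hR.le).2 (hint.mono_set Ioc_subset_Ioi_self)
  have hJR : IntervalIntegrable (fun t => (1 - b ^ 2) * (besselJ n (b * t) * besselJ n t))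
      volume 0 R := (continuous_const.mul hJc).intervalIntegrable 0 R
  have hftc := intervalIntegral.integral_eq_sub_of_hasDerivAt_of_tendsto
    (f := fun t => t ^ ((1 : ℝ) - 2) * lommel n b t)
    (f' := fun t => (1 - b ^ 2) * (besselJ n (b * t) * besselJ n t) -
      t ^ ((1 : ℝ) - 3) * lommel n b t) hR
    (fun t ht => by
      have ht' : 0 < t := ht.1
      refine ((Real.hasDerivAt_rpow_const (Or.inl ht'.ne')).mul
        (hasDerivAt_lommel n hb ht')).congr_deriv ?_
      have e : t ^ ((1 : ℝ) - 2) * t = 1 := by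
        rw [← Real.rpow_add_one ht'.ne']; norm_num
      rw [show (1 : ℝ) - 2 - 1 = 1 - 3 by norm_num]
      linear_combination (1 - b ^ 2) * (besselJ n (b * t) * besselJ n t) * e)
    (hJR.sub hintR) hz (by
      have hRc : ContinuousAt (fun t => t ^ ((1 : ℝ) - 2) * lommel n b t) R :=
        (Real.continuousAt_rpow_const R _ (Or.inl hR.ne')).mul (continuous_lommel n b).continuousAt
      exact hRc.tendsto.mono_left nhdsWithin_le_nhds)
  rw [intervalIntegral.integral_sub hJR hintR, intervalIntegral.integral_const_mul, sub_zero]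
    at hftc
  simp only [id]
  linarith

/-- The integral of `J_n(bt) J_n(t)` converges and is the limit of the integrals with the factor
`t^{a-1}`, `a → 1⁻`. -/
lemma exists_tendsto_integral_mul_besselJ (n : ℕ) {b : ℝ} (hb : 0 < b) (hb1 : b < 1) :
    ∃ I : ℝ, Tendsto (fun R : ℝ => ∫ t in (0 : ℝ)..R, besselJ n (b * t) * besselJ n t)
      atTop (𝓝 I) ∧ Tendsto (fun a : ℝ => Lam a n b) (𝓝[<] 1) (𝓝 (1 / b * I)) := by
  have hb2 : 1 - b ^ 2 ≠ 0 := by nlinarith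
  refine ⟨(1 - b ^ 2)⁻¹ * ∫ t in Ioi (0 : ℝ), t ^ ((1 : ℝ) - 3) * lommel n b t, ?_, ?_⟩
  · refine ((tendsto_intervalIntegral_mul_besselJ n hb hb1.le).const_mul (1 - b ^ 2)⁻¹).congr
      fun R => ?_
    rw [inv_mul_cancel_left₀ hb2]
  · refine Tendsto.const_mul (1 / b) ?_
    have h1 : Tendsto (fun a : ℝ => 2 - a) (𝓝[<] 1) (𝓝 1) := by
      have : Continuous fun a : ℝ => 2 - a := by fun_prop
      have := (this.tendsto 1).mono_left (nhdsWithin_le_nhds (s := Iio 1))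
      norm_num at this
      exact this
    have h2 := ((h1.mul (tendsto_integral_rpow_mul_lommel n hb hb1.le)).const_mul (1 - b ^ 2)⁻¹)
    rw [one_mul] at h2
    refine h2.congr' ?_
    filter_upwards [(Ioo_mem_nhdsLT (by norm_num) : Ioo (1 / 2 : ℝ) 1 ∈ 𝓝[<] 1)] with a ha
    rw [← one_sub_sq_mul_integral_lambdaIntegrand n hb hb1.le ha.1 ha.2, inv_mul_cancel_left₀ hb2]

/-! ### Limits in α of Λ_n and Θ_n. -/

lemma continuousAt_Gamma_of_pos {x : ℝ} (hx : 0 < x) : ContinuousAt Real.Gamma x :=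
  (Real.differentiableAt_Gamma fun m => by
    have : (0 : ℝ) ≤ m := Nat.cast_nonneg m
    linarith).continuousAt

lemma tendsto_eulerIntegral_zero {b : ℝ} (hb0 : 0 < b) (hb1 : b ≤ 1) {n : ℕ} (hn : 1 ≤ n) :
    Tendsto (fun s => eulerIntegral s n b) (𝓝[>] 0) (𝓝 (1 / n)) := by
  have hn' : (1 : ℝ) ≤ n := by exact_mod_cast hn
  have e : ∫ x in Ioo (0 : ℝ) 1, x ^ ((n : ℝ) - 1) * (1 - x) ^ ((1 : ℝ) - 1) = 1 / n := by
    rw [integral_rpow_mul_one_sub_rpow (by linarith) one_pos, Real.Gamma_one,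
      Real.Gamma_add_one (by linarith)]
    have := (Real.Gamma_pos_of_pos (by linarith : (0 : ℝ) < n)).ne'
    field_simp
  rw [← e]
  have hev : Ioo (0 : ℝ) (1 / 4) ∈ 𝓝[>] 0 := Ioo_mem_nhdsGT (by norm_num)
  -- For s < 1/4 the exponent -2s of 1 - x exceeds -1/2, and the power of x is at most 1; the
  -- exponents are spelled to fit the Beta integral.
  refine tendsto_integral_filter_of_dominated_convergence
    (fun x => x ^ ((1 : ℝ) - 1) * (1 - x) ^ ((1 / 2 : ℝ) - 1)) ?_ ?_
    (integrableOn_rpow_mul_one_sub_rpow one_pos (by norm_num)) ?_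
  · exact Eventually.of_forall fun s => aestronglyMeasurable_eulerIntegrand s n hb0 hb1
  · filter_upwards [hev] with s hs
    filter_upwards [ae_restrict_mem measurableSet_Ioo] with x hx
    have h1 : 0 < 1 - x := by linarith [hx.2]
    rw [Real.norm_of_nonneg (eulerIntegrand_pos s n hb0 hb1 hx).le]
    refine (eulerIntegrand_le hs.1.le n hb0 hb1 le_rfl hx).trans ?_
    rw [eulerIntegrand_one s n hx]
    have h2 : x ^ ((n : ℝ) + s - 1) ≤ x ^ ((1 : ℝ) - 1) :=
      Real.rpow_le_rpow_of_exponent_ge hx.1 hx.2.le (by linarith [hs.1])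
    have h3 : (1 - x) ^ (1 - 2 * s - 1) ≤ (1 - x) ^ ((1 / 2 : ℝ) - 1) :=
      Real.rpow_le_rpow_of_exponent_ge h1 (by linarith [hx.1]) (by linarith [hs.2])
    have h0 := hx.1
    gcongr
  · filter_upwards [ae_restrict_mem measurableSet_Ioo] with x hx
    have h1 : 0 < 1 - x := by linarith [hx.2]
    have hc : Continuous fun s => eulerIntegrand s n b x := by
      refine Continuous.mul (Continuous.mul ?_ ?_) ?_
      · exact (Real.continuous_const_rpow hx.1.ne').comp (by fun_prop)
      · exact (Real.continuous_const_rpow h1.ne').comp (by fun_prop)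
      · exact (Real.continuous_const_rpow (one_sub_mul_pos hb0 hb1 hx).ne').comp (by fun_prop)
    have := (hc.tendsto 0).mono_left (nhdsWithin_le_nhds (s := Ioi 0))
    simpa [eulerIntegrand] using this

lemma Lam_eq {α b : ℝ} (hα : α ∈ Ioo (0 : ℝ) 1) {n : ℕ} (hn : 1 ≤ n) (hb0 : 0 < b) (hb1 : b ≤ 1) :
    Lam α n b = 2 ^ (α - 1) / Real.Gamma (1 - α / 2) ^ 2 *
      (b ^ (n - 1) * eulerIntegral (α / 2) n b) := by
  have := Lam_eq_eulerIntegral (s := α / 2) (by linarith [hα.1]) (by linarith [hα.2]) hn hb0 hb1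
  rwa [mul_div_cancel₀ α two_ne_zero] at this

lemma Lam_one {α : ℝ} (hα : α ∈ Ioo (0 : ℝ) 1) {n : ℕ} (hn : 1 ≤ n) :
    Lam α n 1 = 2 ^ (α - 1) * Real.Gamma (1 - α) / Real.Gamma (1 - α / 2) ^ 2 *
      (Real.Gamma (n + α / 2) / Real.Gamma (n + 1 - α / 2)) := by
  have := Lam_one_eq (s := α / 2) (by linarith [hα.1]) (by linarith [hα.2]) hn
  rwa [mul_div_cancel₀ α two_ne_zero] at this

lemma Lam_coeff_pos {α : ℝ} (hα : α ∈ Ioo (0 : ℝ) 1) :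
    0 < 2 ^ (α - 1) / Real.Gamma (1 - α / 2) ^ 2 := by
  have := Real.Gamma_pos_of_pos (by linarith [hα.2] : 0 < 1 - α / 2)
  positivity

lemma tendsto_Lam_zero {b : ℝ} (hb0 : 0 < b) (hb1 : b ≤ 1) {n : ℕ} (hn : 1 ≤ n) :
    Tendsto (fun α => Lam α n b) (𝓝[>] 0) (𝓝 (b ^ (n - 1) / (2 * n))) := by
  have h2 : Tendsto (fun α : ℝ => α / 2) (𝓝[>] 0) (𝓝[>] 0) := by
    refine tendsto_nhdsWithin_iff.2 ⟨?_, ?_⟩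
    · have : Continuous fun α : ℝ => α / 2 := by fun_prop
      simpa using (this.tendsto 0).mono_left (nhdsWithin_le_nhds (s := Ioi 0))
    · filter_upwards [self_mem_nhdsWithin] with α hα
      exact half_pos (mem_Ioi.1 hα)
  have hc : ContinuousAt (fun α : ℝ => (2 : ℝ) ^ (α - 1) / Real.Gamma (1 - α / 2) ^ 2) 0 := by
    have hG : ContinuousAt (fun α : ℝ => Real.Gamma (1 - α / 2)) 0 :=
      ContinuousAt.comp (f := fun α : ℝ => 1 - α / 2) (continuousAt_Gamma_of_pos (by norm_num))
        (by fun_prop)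
    refine ContinuousAt.div ?_ (hG.pow 2) (by simp)
    exact ((Real.continuous_const_rpow two_ne_zero).comp
      (by fun_prop : Continuous fun α : ℝ => α - 1)).continuousAt
  have h := (hc.tendsto.mono_left (nhdsWithin_le_nhds (s := Ioi 0))).mul
    (((tendsto_eulerIntegral_zero hb0 hb1 hn).comp h2).const_mul (b ^ (n - 1)))
  have e : (2 : ℝ) ^ ((0 : ℝ) - 1) / Real.Gamma (1 - 0 / 2) ^ 2 * (b ^ (n - 1) * (1 / n)) =
      b ^ (n - 1) / (2 * n) := by
    rw [zero_sub, Real.rpow_neg_one]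
    simp
    ring
  rw [e] at h
  refine h.congr' ?_
  filter_upwards [(Ioo_mem_nhdsGT one_pos : Ioo (0 : ℝ) 1 ∈ 𝓝[>] 0)] with α hα
  exact (Lam_eq hα hn hb0 hb1).symm

lemma tendsto_Theta_zero {n : ℕ} (hn : 1 ≤ n) :
    Tendsto (fun α => Theta α n) (𝓝[>] 0) (𝓝 (((n : ℝ) - 1) / (2 * n))) := by
  have h := (tendsto_Lam_zero one_pos le_rfl le_rfl).sub (tendsto_Lam_zero one_pos le_rfl hn)
  have hn0 : (n : ℝ) ≠ 0 := by positivity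
  have e : (1 : ℝ) ^ (1 - 1) / (2 * (1 : ℕ)) - 1 ^ (n - 1) / (2 * n) = ((n : ℝ) - 1) / (2 * n) := by
    simp
    field_simp
  rw [e] at h
  exact h

/-- The difference produces the factor 1 - α, which absorbs the pole of Γ(1-α) at α = 1 into Γ(2-α).
All factors are positive, so it also gives the monotonicity of Θ_n. -/
lemma Lam_one_sub_Lam_one_succ {α : ℝ} (hα : α ∈ Ioo (0 : ℝ) 1) {n : ℕ} (hn : 1 ≤ n) :
    Lam α n 1 - Lam α (n + 1) 1 = 2 ^ (α - 1) * Real.Gamma (2 - α) / Real.Gamma (1 - α / 2) ^ 2 *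
      (Real.Gamma (n + α / 2) / Real.Gamma (n + 2 - α / 2)) := by
  obtain ⟨h0, h1⟩ := hα
  have hn' : (1 : ℝ) ≤ n := by exact_mod_cast hn
  have e1 : Real.Gamma (((n + 1 : ℕ) : ℝ) + α / 2) = (n + α / 2) * Real.Gamma (n + α / 2) := by
    rw [← Real.Gamma_add_one (by positivity)]; congr 1; push_cast; ring
  have e2 : Real.Gamma (n + 2 - α / 2) = (n + 1 - α / 2) * Real.Gamma (n + 1 - α / 2) := by
    rw [← Real.Gamma_add_one (by linarith)]; congr 1; ring
  have e3 : Real.Gamma (((n + 1 : ℕ) : ℝ) + 1 - α / 2) =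
      (n + 1 - α / 2) * Real.Gamma (n + 1 - α / 2) := by
    rw [← e2]; congr 1; push_cast; ring
  have e4 : Real.Gamma (2 - α) = (1 - α) * Real.Gamma (1 - α) := by
    rw [← Real.Gamma_add_one (by linarith)]; congr 1; ring
  rw [Lam_one ⟨h0, h1⟩ hn, Lam_one ⟨h0, h1⟩ (by omega), e1, e2, e3, e4]
  have p1 : (n : ℝ) + 1 - α / 2 ≠ 0 := by linarith
  have p2 := (Real.Gamma_pos_of_pos (by linarith : 0 < (n : ℝ) + 1 - α / 2)).ne'
  have p3 := (Real.Gamma_pos_of_pos (by linarith : 0 < 1 - α / 2)).ne'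
  have p4 : (n : ℝ) + α / 2 = (n + 1 - α / 2) - (1 - α) := by ring
  generalize Real.Gamma (n + 1 - α / 2) = A at *
  generalize Real.Gamma (1 - α / 2) = B at *
  generalize Real.Gamma (n + α / 2) = G at *
  rw [p4]
  generalize (n : ℝ) + 1 - α / 2 = c at *
  field_simp
  ring

lemma tendsto_Lam_one_sub_Lam_one_succ {n : ℕ} (hn : 1 ≤ n) :
    Tendsto (fun α => Lam α n 1 - Lam α (n + 1) 1) (𝓝[<] 1)
      (𝓝 (2 / Real.pi * (1 / (2 * (n : ℝ) + 1)))) := by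
  have hn' : (1 : ℝ) ≤ n := by exact_mod_cast hn
  have hG : ∀ c d : ℝ, 0 < c + d → ContinuousAt (fun α : ℝ => Real.Gamma (c + d * α)) 1 :=
    fun c d h => ContinuousAt.comp (f := fun α : ℝ => c + d * α)
      (continuousAt_Gamma_of_pos (by linarith)) (by fun_prop)
  have h2 : ContinuousAt (fun α : ℝ => (2 : ℝ) ^ (α - 1)) 1 :=
    ((Real.continuous_const_rpow two_ne_zero).comp
      (by fun_prop : Continuous fun α : ℝ => α - 1)).continuousAt
  have hpos : ∀ x : ℝ, 0 < x → Real.Gamma x ≠ 0 := fun x hx => (Real.Gamma_pos_of_pos hx).ne'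
  have hc : ContinuousAt (fun α : ℝ => (2 : ℝ) ^ (α - 1) * Real.Gamma (2 + (-1) * α) /
      Real.Gamma (1 + (-(1 / 2)) * α) ^ 2 *
      (Real.Gamma (n + 1 / 2 * α) / Real.Gamma (n + 2 + (-(1 / 2)) * α))) 1 := by
    refine ((h2.mul (hG _ _ (by norm_num))).div ((hG _ _ (by norm_num)).pow 2) ?_).mul
      ((hG _ _ (by linarith)).div (hG _ _ (by linarith)) ?_)
    · exact pow_ne_zero 2 (hpos _ (by norm_num))
    · exact hpos _ (by linarith)
  have h := hc.tendsto.mono_left (nhdsWithin_le_nhds (s := Iio 1))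
  have e : (2 : ℝ) ^ ((1 : ℝ) - 1) * Real.Gamma (2 + (-1) * 1) /
      Real.Gamma (1 + (-(1 / 2)) * 1) ^ 2 *
      (Real.Gamma (n + 1 / 2 * 1) / Real.Gamma (n + 2 + (-(1 / 2)) * 1)) =
      2 / Real.pi * (1 / (2 * (n : ℝ) + 1)) := by
    have e1 : Real.Gamma (n + 2 + (-(1 / 2)) * 1) = (n + 1 / 2) * Real.Gamma (n + 1 / 2 * 1) := by
      rw [mul_one (1 / 2 : ℝ), ← Real.Gamma_add_one (by positivity)]; congr 1; ring
    have e2 : Real.Gamma (1 + (-(1 / 2)) * 1) ^ 2 = Real.pi := by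
      rw [show (1 : ℝ) + (-(1 / 2)) * 1 = 1 / 2 by norm_num, Real.Gamma_one_half_eq,
        Real.sq_sqrt Real.pi_pos.le]
    have e3 : Real.Gamma (2 + (-1) * 1) = 1 := by
      rw [show (2 : ℝ) + (-1) * 1 = 1 by norm_num, Real.Gamma_one]
    have := hpos (n + 1 / 2 * 1) (by positivity)
    rw [e1, e2, e3, sub_self, Real.rpow_zero]
    field_simp
  rw [e] at h
  refine h.congr' ?_
  filter_upwards [(Ioo_mem_nhdsLT one_pos : Ioo (0 : ℝ) 1 ∈ 𝓝[<] 1)] with α hα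
  rw [Lam_one_sub_Lam_one_succ hα hn]
  congr 2 <;> ring_nf

lemma tendsto_Theta_one {n : ℕ} (hn : 1 ≤ n) :
    Tendsto (fun α => Theta α n) (𝓝[<] 1)
      (𝓝 (2 / Real.pi * ∑ k ∈ Finset.Icc 1 (n - 1), 1 / (2 * (k : ℝ) + 1))) := by
  induction n, hn using Nat.le_induction with
  | base => simp [Theta]
  | succ n hn ih =>
    have h := ih.add (tendsto_Lam_one_sub_Lam_one_succ hn)
    obtain ⟨m, rfl⟩ := Nat.exists_eq_add_of_le' hn
    rw [← mul_add, Nat.add_sub_cancel, ← Finset.sum_Icc_succ_top (by omega)] at h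
    rw [Nat.add_sub_cancel]
    refine h.congr fun α => ?_
    simp only [Theta]
    ring

/-! ### Signs and monotonicity. -/

lemma eulerIntegral_pos {s b : ℝ} (hs0 : 0 ≤ s) (hs1 : s < 1 / 2) {n : ℕ} (hn : 1 ≤ n)
    (hb0 : 0 < b) (hb1 : b ≤ 1) : 0 < eulerIntegral s n b := by
  refine (setIntegral_pos_iff_support_of_nonneg_ae ?_
    (integrableOn_eulerIntegrand hs0 hs1 hn hb0 hb1)).2 ?_
  · filter_upwards [ae_restrict_mem measurableSet_Ioo] with x hx
    exact (eulerIntegrand_pos s n hb0 hb1 hx).le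
  · have : Function.support (eulerIntegrand s n b) ∩ Ioo 0 1 = Ioo 0 1 :=
      inter_eq_right.2 fun x hx => (eulerIntegrand_pos s n hb0 hb1 hx).ne'
    rw [this]
    simp

lemma eulerIntegral_lt {s b b' : ℝ} (hs0 : 0 < s) (hs1 : s < 1 / 2) {n : ℕ} (hn : 1 ≤ n)
    (hb0 : 0 < b) (hbb : b < b') (hb1 : b' ≤ 1) : eulerIntegral s n b < eulerIntegral s n b' := by
  have i1 := integrableOn_eulerIntegrand hs0.le hs1 hn hb0 (hbb.le.trans hb1)
  have i2 := integrableOn_eulerIntegrand hs0.le hs1 hn (hb0.trans hbb) hb1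
  have hpos : ∀ x ∈ Ioo (0 : ℝ) 1, 0 < eulerIntegrand s n b' x - eulerIntegrand s n b x := by
    intro x hx
    have h0 := hx.1
    have h1 : 0 < 1 - x := by linarith [hx.2]
    rw [eulerIntegrand, eulerIntegrand, ← mul_sub]
    refine mul_pos (by positivity) (sub_pos.2 ?_)
    refine Real.rpow_lt_rpow_of_neg (one_sub_mul_pos (hb0.trans hbb) hb1 hx) ?_ (by linarith)
    have : b ^ 2 < b' ^ 2 := by gcongr
    nlinarith
  rw [← sub_pos, eulerIntegral, eulerIntegral, ← integral_sub i2 i1]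
  refine (setIntegral_pos_iff_support_of_nonneg_ae ?_ (i2.sub i1)).2 ?_
  · filter_upwards [ae_restrict_mem measurableSet_Ioo] with x hx
    exact (hpos x hx).le
  · have : Function.support (eulerIntegrand s n b' - eulerIntegrand s n b) ∩
        Ioo 0 1 = Ioo 0 1 := inter_eq_right.2 fun x hx => (hpos x hx).ne'
    rw [this]
    simp

lemma eulerIntegral_succ_le {s b : ℝ} (hs0 : 0 ≤ s) (hs1 : s < 1 / 2) {n : ℕ} (hn : 1 ≤ n)
    (hb0 : 0 < b) (hb1 : b ≤ 1) : eulerIntegral s (n + 1) b ≤ eulerIntegral s n b := by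
  refine setIntegral_mono_on (integrableOn_eulerIntegrand hs0 hs1 (by omega) hb0 hb1)
    (integrableOn_eulerIntegrand hs0 hs1 hn hb0 hb1) measurableSet_Ioo fun x hx => ?_
  have h1 : 0 < 1 - x := by linarith [hx.2]
  have h2 := one_sub_mul_pos hb0 hb1 hx
  rw [eulerIntegrand, eulerIntegrand]
  have h3 : x ^ (((n + 1 : ℕ) : ℝ) + s - 1) ≤ x ^ ((n : ℝ) + s - 1) :=
    Real.rpow_le_rpow_of_exponent_ge hx.1 hx.2.le (by push_cast; linarith)
  gcongr

lemma Lam_pos {α b : ℝ} (hα : α ∈ Ioo (0 : ℝ) 1) {n : ℕ} (hn : 1 ≤ n) (hb0 : 0 < b)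
    (hb1 : b ≤ 1) : 0 < Lam α n b := by
  rw [Lam_eq hα hn hb0 hb1]
  exact mul_pos (Lam_coeff_pos hα) (mul_pos (pow_pos hb0 _)
    (eulerIntegral_pos (by linarith [hα.1]) (by linarith [hα.2]) hn hb0 hb1))

lemma strictMonoOn_Lam {α : ℝ} (hα : α ∈ Ioo (0 : ℝ) 1) {n : ℕ} (hn : 1 ≤ n) :
    StrictMonoOn (fun β => Lam α n β) (Ioo 0 1) := by
  intro β hβ β' hβ' h
  simp only
  rw [Lam_eq hα hn hβ.1 hβ.2.le, Lam_eq hα hn hβ'.1 hβ'.2.le]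
  have h1 := eulerIntegral_lt (s := α / 2) (by linarith [hα.1]) (by linarith [hα.2]) hn hβ.1 h
    hβ'.2.le
  have h2 := eulerIntegral_pos (s := α / 2) (by linarith [hα.1]) (by linarith [hα.2]) hn hβ'.1
    hβ'.2.le
  have h3 : β ^ (n - 1) ≤ β' ^ (n - 1) := pow_le_pow_left₀ hβ.1.le h.le _
  refine mul_lt_mul_of_pos_left ?_ (Lam_coeff_pos hα)
  -- Strictness comes from the Euler integral, because the power of β is constant when n = 1.
  exact mul_lt_mul' h3 h1 (eulerIntegral_pos (by linarith [hα.1]) (by linarith [hα.2]) hn hβ.1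
    hβ.2.le).le (pow_pos hβ'.1 _)

lemma strictAntiOn_Lam {α b : ℝ} (hα : α ∈ Ioo (0 : ℝ) 1) (hb : b ∈ Ioo (0 : ℝ) 1) :
    StrictAntiOn (fun n : ℕ => Lam α n b) (Ici 1) := by
  refine strictAntiOn_of_add_one_lt ordConnected_Ici fun n _ hn _ => ?_
  have hn : 1 ≤ n := hn
  rw [Lam_eq hα hn hb.1 hb.2.le, Lam_eq hα (by omega) hb.1 hb.2.le]
  have h1 := eulerIntegral_succ_le (s := α / 2) (by linarith [hα.1]) (by linarith [hα.2]) hn hb.1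
    hb.2.le
  have h2 := eulerIntegral_pos (s := α / 2) (n := n) (by linarith [hα.1]) (by linarith [hα.2]) hn
    hb.1 hb.2.le
  refine mul_lt_mul_of_pos_left ?_ (Lam_coeff_pos hα)
  refine (mul_le_mul_of_nonneg_left h1 (pow_nonneg hb.1.le _)).trans_lt ?_
  -- Strictness comes here from the power of b, hence from b < 1.
  exact mul_lt_mul_of_pos_right (pow_lt_pow_right_of_lt_one₀ hb.1 hb.2 (by omega)) h2

lemma strictMonoOn_Theta {α : ℝ} (hα : α ∈ Ioo (0 : ℝ) 1) :
    StrictMonoOn (fun n : ℕ => Theta α n) (Ici 1) := by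
  refine strictMonoOn_of_lt_add_one ordConnected_Ici fun n _ hn _ => ?_
  have hn : 1 ≤ n := hn
  have hn' : (1 : ℝ) ≤ n := by exact_mod_cast hn
  simp only [Theta]
  refine sub_lt_sub_left (sub_pos.1 ?_) _
  obtain ⟨h0, h1⟩ := hα
  rw [Lam_one_sub_Lam_one_succ ⟨h0, h1⟩ hn]
  have p1 := Real.Gamma_pos_of_pos (by linarith : 0 < 2 - α)
  have p2 := Real.Gamma_pos_of_pos (by linarith : 0 < 1 - α / 2)
  have p3 := Real.Gamma_pos_of_pos (by linarith : 0 < n + α / 2)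
  have p4 := Real.Gamma_pos_of_pos (by linarith : 0 < n + 2 - α / 2)
  positivity

lemma Theta_nonneg {α : ℝ} (hα : α ∈ Ioo (0 : ℝ) 1) {n : ℕ} (hn : 1 ≤ n) : 0 ≤ Theta α n := by
  have := (strictMonoOn_Theta hα).monotoneOn (mem_Ici.2 le_rfl) (mem_Ici.2 hn) hn
  simpa [Theta] using this

/-! ### Asymptotics as n → ∞. -/

/-- The factor Γ(1+α/2)/Γ(2-α/2) of Λ_1(1) cancels against (1-α/2) Γ(1-α/2)/Γ(1+α/2), leaving the
n-independent prefactor of `Lam_one`. -/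
lemma kappa_eq {α : ℝ} (hα : α ∈ Ioo (0 : ℝ) 1) :
    kappa α = 2 ^ (α - 1) * Real.Gamma (1 - α) / Real.Gamma (1 - α / 2) ^ 2 := by
  obtain ⟨h0, h1⟩ := hα
  have h := exp_cAlpha_eq (z := α / 2) (by linarith) (by linarith)
  rw [mul_div_cancel₀ α two_ne_zero] at h
  rw [kappa, h, Lam_one ⟨h0, h1⟩ le_rfl, Nat.cast_one, add_sub_assoc, add_comm 1 (1 - α / 2),
    Real.Gamma_add_one (by linarith)]
  have p1 := (Real.Gamma_pos_of_pos (by linarith : 0 < 1 - α / 2)).ne'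
  have p2 := (Real.Gamma_pos_of_pos (by linarith : 0 < 1 + α / 2)).ne'
  have p3 : 1 - α / 2 ≠ 0 := by linarith
  generalize Real.Gamma (1 - α / 2) = B at *
  generalize Real.Gamma (1 + α / 2) = D at *
  generalize 1 - α / 2 = c at *
  field_simp

lemma abs_Lam_one_sub_le {α : ℝ} (hα : α ∈ Ioo (0 : ℝ) 1) {n : ℕ} (hn : 1 ≤ n) :
    |Lam α n 1 - kappa α / (n : ℝ) ^ (1 - α)| ≤ |kappa α| * (1 / (n : ℝ) ^ (2 - α)) := by
  have hn0 : (0 : ℝ) < n := by exact_mod_cast hn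
  have h := abs_Gamma_div_sub_rpow_le (x := n) (s := α / 2) hn0 (by linarith [hα.1])
    (by linarith [hα.2])
  rw [mul_div_cancel₀ α two_ne_zero] at h
  have e : Lam α n 1 - kappa α / (n : ℝ) ^ (1 - α) = kappa α *
      (Real.Gamma (n + α / 2) / Real.Gamma (n + 1 - α / 2) - (n : ℝ) ^ (α - 1)) := by
    rw [Lam_one hα hn, ← kappa_eq hα, show α - 1 = -(1 - α) by ring, Real.rpow_neg hn0.le]
    ring
  rw [e, abs_mul, one_div, ← Real.rpow_neg hn0.le, neg_sub]
  gcongr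

lemma isBigO_Theta {α : ℝ} (hα : α ∈ Ioo (0 : ℝ) 1) :
    (fun n : ℕ => Theta α n - (Lam α 1 1 - kappa α / (n : ℝ) ^ (1 - α)))
      =O[atTop] (fun n : ℕ => 1 / (n : ℝ) ^ (2 - α)) := by
  refine IsBigO.of_bound |kappa α| ?_
  filter_upwards [eventually_ge_atTop 1] with n hn
  have h := abs_Lam_one_sub_le hα hn
  rw [Real.norm_eq_abs, Real.norm_of_nonneg (by positivity), Theta,
    show Lam α 1 1 - Lam α n 1 - (Lam α 1 1 - kappa α / (n : ℝ) ^ (1 - α)) =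
      -(Lam α n 1 - kappa α / (n : ℝ) ^ (1 - α)) by ring, abs_neg]
  exact h

lemma tendsto_one_div_nat_rpow {p : ℝ} (hp : 0 < p) :
    Tendsto (fun n : ℕ => 1 / (n : ℝ) ^ p) atTop (𝓝 0) := by
  refine ((tendsto_rpow_atTop hp).comp tendsto_natCast_atTop_atTop).inv_tendsto_atTop.congr
    fun n => ?_
  simp

lemma tendsto_Theta_atTop {α : ℝ} (hα : α ∈ Ioo (0 : ℝ) 1) :
    Tendsto (fun n : ℕ => Theta α n) atTop (𝓝 (Lam α 1 1)) := by
  have h1 := (isBigO_Theta hα).trans_tendsto (tendsto_one_div_nat_rpow (by linarith [hα.2]))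
  have h2 := (tendsto_one_div_nat_rpow (by linarith [hα.2] : 0 < 1 - α)).const_mul (kappa α)
  have h3 := (h1.sub h2).add_const (Lam α 1 1)
  rw [mul_zero, sub_zero, zero_add] at h3
  refine h3.congr fun n => ?_
  ring

lemma eulerIntegral_le_one {s b : ℝ} (hs0 : 0 ≤ s) (hs1 : s < 1 / 2) {n : ℕ} (hn : 1 ≤ n)
    (hb0 : 0 < b) (hb1 : b ≤ 1) : eulerIntegral s n b ≤ eulerIntegral s 1 b := by
  induction n, hn using Nat.le_induction with
  | base => exact le_rfl
  | succ n hn ih => exact (eulerIntegral_succ_le hs0 hs1 hn hb0 hb1).trans ih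

lemma isBigO_Lam {α b : ℝ} (hα : α ∈ Ioo (0 : ℝ) 1) (hb : b ∈ Ioo (0 : ℝ) 1) :
    (fun n : ℕ => Lam α n b) =O[atTop] (fun n : ℕ => b ^ (n - 1)) := by
  refine IsBigO.of_bound (2 ^ (α - 1) / Real.Gamma (1 - α / 2) ^ 2 * eulerIntegral (α / 2) 1 b) ?_
  filter_upwards [eventually_ge_atTop 1] with n hn
  have h1 := eulerIntegral_le_one (s := α / 2) (by linarith [hα.1]) (by linarith [hα.2]) hn hb.1
    hb.2.le
  have h2 := Lam_coeff_pos hα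
  have hb0 := hb.1
  rw [Real.norm_of_nonneg (Lam_pos hα hn hb.1 hb.2.le).le, Real.norm_of_nonneg (by positivity),
    Lam_eq hα hn hb.1 hb.2.le, mul_assoc, mul_comm (b ^ (n - 1))]
  gcongr

lemma isBigO_pow_pred {α b : ℝ} (hα : 0 < α) (hb : b ∈ Ioo (0 : ℝ) 1) :
    (fun n : ℕ => b ^ (n - 1)) =O[atTop] (fun n : ℕ => 1 / (n : ℝ) ^ (2 - α)) := by
  have hb0 := hb.1
  have h := tendsto_pow_const_mul_const_pow_of_abs_lt_one 2 (r := b)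
    (by rw [abs_of_pos hb.1]; exact hb.2)
  have h1 := (h.eventually (eventually_le_nhds one_pos))
  -- Eventually n² bⁿ ≤ 1, and 2 - α ≤ 2; the factor b⁻¹ passes from bⁿ to b^(n-1).
  refine IsBigO.of_bound b⁻¹ ?_
  filter_upwards [h1, eventually_ge_atTop 1] with n h2 hn
  have hn0 : (0 : ℝ) < n := by exact_mod_cast hn
  have hn1 : (1 : ℝ) ≤ n := by exact_mod_cast hn
  rw [Real.norm_of_nonneg (by positivity), Real.norm_of_nonneg (by positivity)]
  have e : b ^ (n - 1) = b⁻¹ * b ^ n := by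
    obtain ⟨m, rfl⟩ := Nat.exists_eq_add_of_le' hn
    rw [Nat.add_sub_cancel, pow_succ]; field_simp
  rw [e]
  gcongr
  rw [le_div_iff₀ (by positivity)]
  refine le_trans ?_ h2
  rw [mul_comm]
  gcongr
  rw [← Real.rpow_natCast]
  exact Real.rpow_le_rpow_of_exponent_le hn1 (by push_cast; linarith)

lemma tendsto_Lam_atTop {α b : ℝ} (hα : α ∈ Ioo (0 : ℝ) 1) (hb : b ∈ Ioo (0 : ℝ) 1) :
    Tendsto (fun n : ℕ => Lam α n b) atTop (𝓝 0) :=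
  ((isBigO_Lam hα hb).trans (isBigO_pow_pred hα.1 hb)).trans_tendsto
    (tendsto_one_div_nat_rpow (by linarith [hα.2]))

/-! ### Expansion of the determinant. -/

/-- Substituting Θ_n = Λ_1(1) - κx + e, the powers of x alone give μ, ν and -b^(1-α)κ². What remains
is e times a factor bounded in the application x = n^(-(1-α)), plus the off-diagonal term b³
Λ_n(b)². -/
lemma det_M_sub_eq (α Ω : ℝ) {b : ℝ} (hb : 0 < b) (n : ℕ) (x : ℝ) :
    (M α b Ω n).det - (mu α b Ω + nu α b Ω * x - b ^ (1 - α) * kappa α ^ 2 * x ^ 2) =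
      (Theta α n - (Lam α 1 1 - kappa α * x)) *
        (b ^ (1 - α) * (Ω + b ^ 2 * Lam α 1 b - Lam α 1 1) -
          (b * Ω + b ^ (1 - α) * Lam α 1 1 - b * Lam α 1 b) +
          2 * b ^ (1 - α) * (kappa α * x) -
          b ^ (1 - α) * (Theta α n - (Lam α 1 1 - kappa α * x))) +
      b ^ 3 * (Lam α n b * Lam α n b) := by
  have hc : b ^ (2 - α) = b * b ^ (1 - α) := by
    rw [mul_comm, ← Real.rpow_add_one hb.ne']; congr 1; ring
  have hnu : nu α b Ω = kappa α * (2 * b ^ (1 - α) * Lam α 1 1 + (b - b ^ (1 - α)) * Ω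
      - b * (1 + b ^ (2 - α)) * Lam α 1 b) := by
    rw [nu, kappa]; ring
  rw [hnu, hc, M, Matrix.det_fin_two_of, mu]
  ring

lemma det_M_asymptotics {α b : ℝ} (hα : α ∈ Ioo (0 : ℝ) 1) (hb : b ∈ Ioo (0 : ℝ) 1) (Ω : ℝ) :
    (fun n : ℕ => (M α b Ω n).det - (mu α b Ω + nu α b Ω / (n : ℝ) ^ (1 - α)
        - b ^ (1 - α) * kappa α ^ 2 / (n : ℝ) ^ (2 - 2 * α)))
      =O[atTop] (fun n : ℕ => 1 / (n : ℝ) ^ (2 - α)) := by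
  have hx := tendsto_one_div_nat_rpow (by linarith [hα.2] : 0 < 1 - α)
  have hE := tendsto_one_div_nat_rpow (by linarith [hα.2] : 0 < 2 - α)
  have he : (fun n : ℕ => Theta α n - (Lam α 1 1 - kappa α * (1 / (n : ℝ) ^ (1 - α))))
      =O[atTop] (fun n : ℕ => 1 / (n : ℝ) ^ (2 - α)) := by
    simpa only [mul_one_div] using isBigO_Theta hα
  have he0 := he.trans_tendsto hE
  have hfac := ((((hx.const_mul (kappa α)).const_mul (2 * b ^ (1 - α))).const_add
    (b ^ (1 - α) * (Ω + b ^ 2 * Lam α 1 b - Lam α 1 1) -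
      (b * Ω + b ^ (1 - α) * Lam α 1 1 - b * Lam α 1 b))).sub
    (he0.const_mul (b ^ (1 - α)))).isBigO_one ℝ
  -- One factor is exponentially small, hence within the error; the other need only be bounded.
  have hlam : (fun n : ℕ => Lam α n b * Lam α n b) =O[atTop]
      (fun n : ℕ => 1 / (n : ℝ) ^ (2 - α)) := by
    simpa using ((isBigO_Lam hα hb).trans (isBigO_pow_pred hα.1 hb)).mul
      ((tendsto_Lam_atTop hα hb).isBigO_one ℝ)
  have hmain := (he.mul hfac).add ((hlam.const_mul_left (b ^ 3)).trans
    (isBigO_of_le _ fun n => by rw [mul_one] : (fun n : ℕ => 1 / (n : ℝ) ^ (2 - α)) =O[atTop]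
      (fun n : ℕ => 1 / (n : ℝ) ^ (2 - α) * 1)))
  simp only [mul_one] at hmain
  refine hmain.congr_left fun n => ?_
  rw [← det_M_sub_eq α Ω hb.1]
  have hsq : (n : ℝ) ^ (2 - 2 * α) = ((n : ℝ) ^ (1 - α)) ^ 2 := by
    rw [← Real.rpow_natCast, ← Real.rpow_mul (Nat.cast_nonneg n)]; congr 1; push_cast; ring
  rw [hsq, div_pow]
  ring

lemma tendsto_det_M {α b : ℝ} (hα : α ∈ Ioo (0 : ℝ) 1) (hb : b ∈ Ioo (0 : ℝ) 1) (Ω : ℝ) :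
    Tendsto (fun n : ℕ => (M α b Ω n).det) atTop (𝓝 (mu α b Ω)) := by
  have hT := tendsto_Theta_atTop hα
  have hL := tendsto_Lam_atTop hα hb
  have h := (((hT.const_sub Ω).add_const (b ^ 2 * Lam α 1 b)).mul
    (((hT.const_mul (b ^ (1 - α))).const_add (b * Ω)).sub_const (b * Lam α 1 b))).add
    ((hL.mul hL).const_mul (b ^ 3))
  rw [mul_zero, mul_zero, add_zero] at h
  refine h.congr fun n => ?_
  rw [M, Matrix.det_fin_two_of]
  ring

end VState

theorem mainTheorem6 (α b : ℝ) (hα : α ∈ Ioo (0 : ℝ) 1) (hb : b ∈ Ioo (0 : ℝ) 1) :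
    -- the integrals defining `Λ_n(β)`, `0 < β ≤ 1`, converge absolutely
    (∀ n : ℕ, 1 ≤ n → ∀ β ∈ Ioc (0 : ℝ) 1,
      IntegrableOn (fun t => VState.lambdaIntegrand α n β t) (Ioi 0)) ∧
    -- (1) signs and monotonicity
    ((∀ n : ℕ, 1 ≤ n → 0 ≤ VState.Theta α n ∧ 0 ≤ VState.Lam α n b) ∧
      (∀ n : ℕ, 1 ≤ n → StrictMonoOn (fun β => VState.Lam α n β) (Ioo 0 1)) ∧
      StrictMonoOn (fun n : ℕ => VState.Theta α n) (Ici 1) ∧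
      StrictAntiOn (fun n : ℕ => VState.Lam α n b) (Ici 1)) ∧
    -- (2) limits as the exponent tends to 0 and to 1
    (∀ n : ℕ, 2 ≤ n →
      Tendsto (fun a : ℝ => VState.Theta a n) (𝓝[>] 0) (𝓝 (((n : ℝ) - 1) / (2 * n))) ∧
      Tendsto (fun a : ℝ => VState.Lam a n b) (𝓝[>] 0) (𝓝 (b ^ (n - 1) / (2 * n))) ∧
      Tendsto (fun a : ℝ => VState.Theta a n) (𝓝[<] 1)
        (𝓝 (2 / Real.pi * ∑ k ∈ Finset.Icc 1 (n - 1), 1 / (2 * (k : ℝ) + 1))) ∧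
      ∃ I : ℝ,
        Tendsto (fun R : ℝ => ∫ t in (0 : ℝ)..R, VState.besselJ n (b * t) * VState.besselJ n t)
          atTop (𝓝 I) ∧
        Tendsto (fun a : ℝ => VState.Lam a n b) (𝓝[<] 1) (𝓝 (1 / b * I))) ∧
    -- (3) asymptotics as `n → ∞`
    ((fun n : ℕ => VState.Lam α n b) =O[atTop] (fun n : ℕ => b ^ (n - 1)) ∧
      Tendsto (fun n : ℕ => VState.Lam α n b) atTop (𝓝 0) ∧
      (fun n : ℕ => VState.Theta α n -
          (VState.Lam α 1 1 - VState.kappa α / (n : ℝ) ^ (1 - α)))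
        =O[atTop] (fun n : ℕ => 1 / (n : ℝ) ^ (2 - α)) ∧
      Tendsto (fun n : ℕ => VState.Theta α n) atTop (𝓝 (VState.Lam α 1 1))) ∧
    -- (4) expansion of the determinant
    (∀ Ω : ℝ,
      (fun n : ℕ => (VState.M α b Ω n).det -
          (VState.mu α b Ω + VState.nu α b Ω / (n : ℝ) ^ (1 - α)
            - b ^ (1 - α) * VState.kappa α ^ 2 / (n : ℝ) ^ (2 - 2 * α)))
        =O[atTop] (fun n : ℕ => 1 / (n : ℝ) ^ (2 - α)) ∧
      Tendsto (fun n : ℕ => (VState.M α b Ω n).det) atTop (𝓝 (VState.mu α b Ω))) := by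
  refine ⟨fun n _ β hβ => VState.integrableOn_lambdaIntegrand hα.1 hα.2 n hβ.1,
    ⟨fun n hn => ⟨VState.Theta_nonneg hα hn, (VState.Lam_pos hα hn hb.1 hb.2.le).le⟩,
      fun n hn => VState.strictMonoOn_Lam hα hn, VState.strictMonoOn_Theta hα,
      VState.strictAntiOn_Lam hα hb⟩,
    fun n hn => ⟨VState.tendsto_Theta_zero (by omega),
      VState.tendsto_Lam_zero hb.1 hb.2.le (by omega), VState.tendsto_Theta_one (by omega),
      VState.exists_tendsto_integral_mul_besselJ n hb.1 hb.2⟩,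
    ⟨VState.isBigO_Lam hα hb, VState.tendsto_Lam_atTop hα hb, VState.isBigO_Theta hα,
      VState.tendsto_Theta_atTop hα⟩,
    fun Ω => ⟨VState.det_M_asymptotics hα hb Ω, VState.tendsto_det_M hα hb Ω⟩⟩
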